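/- **Setting.** Let $a,b$ be the automorphisms of the binary tree $\{0,1\}^*$ (acting also on its boundary $\{0,1\}^\omega$) given by $a(1w)=1w$, $a(0w)=0\,b(w)$, $b(1w)=0w$, $b(0w)=1\,a(w)$. The Basilica group is the group they generate. For $v\in\{0,1\}^\omega$ the orbital Schreier graph $\Gamma_v$ is the multigraph whose vertices are the points of the orbit of $v$ under the Basilica group, with one edge labelled $s$ from $u$ to $s(u)$ for each vertex $u$ and each $s\in\{a,b\}$ (loops and double edges are kept). The finite Schreier graph $\Gamma_n$ is defined in the same way on $\{0,1\}^n$. For $n\ge 2$, cut $\Gamma_n$ open at the vertex $0^n$, i.e. replace $0^n$ by four vertices, one for each edge end at $0^n$. This gives two graphs with two of the new vertices each, and $G_n$ is the larger one. Its non-boundary vertices are the words of length $n$, other than $0^n$, that have an even number of trailing zeros. Its two boundary vertices are written $0^{n-1}x$ and $0^{n-1}y$; $0^{n-1}x$ is the end of the edge of $G_n$ that arrives at $0^n$ in $\Gamma_n$, and $0^{n-1}y$ is the start of the edge that leaves $0^n$ (for $n\ge3$, $0^{n-1}x$ is joined to a word ending in $0$ and $0^{n-1}y$ to a word ending in $1$).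 An infinite blowup of the graphs $G_n$ is given by integers $k_1=2$, $k_{n+1}-k_n\in\{1,2\}$, and graph morphisms $\iota_{k_n}:G_{k_n}\to G_{k_{n+1}}$ of the following type. If $k_{n+1}-k_n=1$, then $\iota_{k_n}$ appends $1$ to each non-boundary word and replaces both $x$ and $y$ by $01$. If $k_{n+1}-k_n=2$, then $\iota_{k_n}$ either appends $00$ to non-boundary words and substitutes $x\mapsto 00x$, $y\mapsto 001$, or appends $01$ to non-boundary words and substitutes $x\mapsto 001$, $y\mapsto 00y$. The blowup is the direct limit graph $G_\infty$ of $(G_{k_n},\iota_{k_n})$ (direct limits of the vertex sets and of the edge sets). A boundary point of $G_\infty$ is a vertex all of whose representatives in the graphs $G_{k_n}$ are boundary vertices. Below, "isomorphic" refers to the underlying undirected, unlabelled multigraphs, and "strongly isomorphic" means that there is an isomorphism that also preserves the directions and labels of the edges. **Theorem.** There is an orbital Schreier graph $\Gamma_{v_0}$ of the Basilica group with exactly four ends such that: 1. every orbital Schreier graph with exactly four ends is strongly isomorphic to $\Gamma_{v_0}$; 2. $\Gamma_{v_0}$ is not isomorphic to any infinite blowup of the graphs $G_n$; 3. every orbital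 Schreier graph that is not isomorphic to $\Gamma_{v_0}$ is strongly isomorphic to some infinite blowup of the graphs $G_n$. Conversely, every infinite blowup of the graphs $G_n$ without boundary points is strongly isomorphic to some orbital Schreier graph, whereas an infinite blowup with a boundary point is not isomorphic to any orbital Schreier graph. -/

import Mathlib

namespace Basilica

/-! ### Multigraphs with directed, labelled edges -/

/-- The two labels `a`, `b` of the generators. -/
inductive Gen
  | a
  | b

/-- A multigraph (loops and multiple edges allowed). Every edge runs from a vertex `src` to a
vertex `tgt` and carries a label. The undirected, unlabelled multigraph underlying it is obtained by
remembering only the unordered pair of end points of each edge. -/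
structure LGraph where
  V : Type
  E : Type
  src : E → V
  tgt : E → V
  lab : E → Gen

namespace LGraph

/-- Isomorphism of the underlying undirected, unlabelled multigraphs. -/
def IsIso (G H : LGraph) : Prop :=
  ∃ (f : G.V ≃ H.V) (g : G.E ≃ H.E),
    ∀ e, s(H.src (g e), H.tgt (g e)) = s(f (G.src e), f (G.tgt e))

/-- Isomorphism preserving also the directions and the labels of the edges. -/
def IsLabelledIso (G H : LGraph) : Prop :=
  ∃ (f : G.V ≃ H.V) (g : G.E ≃ H.E), ∀ e,
    H.src (g e) = f (G.src e) ∧ H.tgt (g e) = f (G.tgt e) ∧ H.lab (g e) = G.lab e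

theorem IsLabelledIso.isIso {G H : LGraph} (h : G.IsLabelledIso H) : G.IsIso H := by
  obtain ⟨f, g, hfg⟩ := h
  exact ⟨f, g, fun e => by rw [(hfg e).1, (hfg e).2.1]⟩

/-- The simple graph of adjacency, without loops, directions, labels and multiplicities. -/
def toSimple (G : LGraph) : SimpleGraph G.V :=
  SimpleGraph.fromRel fun p q => ∃ e, G.src e = p ∧ G.tgt e = q

/-- The graph has exactly four ends. -/
def HasFourEnds (G : LGraph) : Prop :=
  Nat.card G.toSimple.end = 4

end LGraph

/-! ### The automaton -/

/-- The states of the automaton; `e` is the identity state. -/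
inductive State
  | e
  | a
  | b

/-- The transition map. The letter `0` is `false`, the letter `1` is `true`. -/
def trans : State → Bool → State
  | State.e, _ => State.e
  | State.a, false => State.b
  | State.a, true => State.e
  | State.b, false => State.a
  | State.b, true => State.e

/-- The output map. -/
def out : State → Bool → Bool
  | State.e, c => c
  | State.a, c => c
  | State.b, c => !c

/-- The non-identity states are the generators. -/
def Gen.state : Gen → State
  | Gen.a => State.a
  | Gen.b => State.b

/-- The self map of the finite words defined by a state of the automaton. -/
def act : State → List Bool → List Bool
  | _, [] => []
  | s, c :: w => out s c :: act (trans s c) w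

/-- The state reached after reading a finite word. -/
def after : State → List Bool → State
  | s, [] => s
  | s, c :: w => after (trans s c) w

/-- Right-infinite words, the boundary of the binary tree. -/
abbrev Word : Type := ℕ → Bool

/-- The state in which the automaton, started in state `s`, reads the `n`-th letter of `v`. -/
def stateAt (s : State) (v : Word) : ℕ → State
  | 0 => s
  | n + 1 => trans (stateAt s v n) (v n)

/-- The self map of the infinite words defined by a state of the automaton. -/
def actInf (s : State) (v : Word) : Word := fun n => out (stateAt s v n) (v n)

/-- The state in which the inverse automaton (input and output letters exchanged) reads the `n`-th
letter of `v`. -/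
def stateAtInv (s : State) (v : Word) : ℕ → State
  | 0 => s
  | n + 1 => trans (stateAtInv s v n) (out (stateAtInv s v n) (v n))

/-- The self map of the infinite words defined by the inverse automaton. -/
def actInfInv (s : State) (v : Word) : Word := fun n => out (stateAtInv s v n) (v n)

theorem out_out (s : State) (c : Bool) : out s (out s c) = c := by
  cases s <;> simp [out]

theorem stateAtInv_actInf (s : State) (v : Word) (n : ℕ) :
    stateAtInv s (actInf s v) n = stateAt s v n := by
  induction n with
  | zero => rfl
  | succ n ih => simp only [stateAtInv, stateAt, ih, actInf, out_out]

theorem stateAt_actInfInv (s : State) (v : Word) (n : ℕ) :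
    stateAt s (actInfInv s v) n = stateAtInv s v n := by
  induction n with
  | zero => rfl
  | succ n ih => simp only [stateAtInv, stateAt, ih, actInfInv]

/-- The automaton map of a state as a permutation of the boundary of the tree. -/
def actPerm (s : State) : Equiv.Perm Word where
  toFun := actInf s
  invFun := actInfInv s
  left_inv v := by
    funext n
    rw [actInfInv, stateAtInv_actInf, actInf, out_out]
  right_inv v := by
    funext n
    rw [actInf, stateAt_actInfInv, actInfInv, out_out]

/-- The Basilica group, acting (faithfully) on the boundary of the binary tree. -/
def basilica : Subgroup (Equiv.Perm Word) :=
  Subgroup.closure (Set.range actPerm)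

theorem actPerm_mem (s : State) : actPerm s ∈ basilica :=
  Subgroup.subset_closure ⟨s, rfl⟩

theorem actPerm_orbit {v u : Word} (s : State) (hu : u ∈ MulAction.orbit basilica v) :
    actPerm s u ∈ MulAction.orbit basilica v := by
  obtain ⟨g, rfl⟩ := hu
  exact ⟨⟨actPerm s, actPerm_mem s⟩ * g, rfl⟩

/-- The orbital Schreier graph of `v`: the vertices are the points of the orbit of `v` under the
Basilica group, and each generator `s ∈ {a, b}` gives one edge from each `u` to `s u`. -/
def schreier (v : Word) : LGraph where
  V := MulAction.orbit basilica v
  E := MulAction.orbit basilica v × Gen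
  src e := e.1
  tgt e := ⟨actPerm e.2.state e.1.1, actPerm_orbit _ e.1.2⟩
  lab e := e.2

/-! ### The graphs `G_n`

The `n`-th finite Schreier graph has the words of length `n` as vertices and an edge `(u, s)` from
`u` to `s u` for each word `u` and each generator `s`. Cutting it open at the vertex `0^n` gives two
graphs, each with two boundary vertices; `G_n` is the larger one. -/

/-- The word `0^n`. -/
def zeros (n : ℕ) : List Bool := List.replicate n false

/-- The words `w ≠ 0^n` of length `n` in the larger part of the `n`-th Schreier graph cut open at
`0^n`: those with an even number of trailing zeros. (The words with an odd number of trailing zeros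
make up the smaller part.) -/
def IsInterior (n : ℕ) (w : List Bool) : Prop :=
  w.length = n ∧ ∃ (u : List Bool) (j : ℕ), w = u ++ true :: zeros (2 * j)

/-- Vertices of `G_n`: the interior words and the two boundary vertices `0^{n-1}x`, `0^{n-1}y`. -/
inductive GVert (n : ℕ) : Type
  | inner (w : List Bool) (h : IsInterior n w) : GVert n
  | x : GVert n
  | y : GVert n

/-- The boundary vertices of `G_n`. -/
def GVert.IsBoundary {n : ℕ} : GVert n → Prop
  | GVert.inner _ _ => False
  | GVert.x => True
  | GVert.y => True

/-- Edges of `G_n`: those edges `(u, s)` of the `n`-th Schreier graph which join two interior words,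
or an interior word and `0^n`. -/
structure GEdge (n : ℕ) : Type where
  word : List Bool
  gen : Gen
  isEdge : (IsInterior n word ∧ IsInterior n (act gen.state word)) ∨
    (IsInterior n word ∧ act gen.state word = zeros n) ∨
    (word = zeros n ∧ IsInterior n (act gen.state word))

open Classical in
/-- Initial vertex of an edge of `G_n`; the edge that leaves `0^n` in the Schreier graph becomes the
edge at `0^{n-1}y` (for `n ≥ 3`, its other end is `0101⋯01` or `1010⋯01`, which ends in `1`). -/
noncomputable def GEdge.src {n : ℕ} (d : GEdge n) : GVert n :=
  if h : IsInterior n d.word then GVert.inner d.word h else GVert.y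

open Classical in
/-- Terminal vertex of an edge of `G_n`; the edge that arrives at `0^n` in the Schreier graph
becomes the edge at `0^{n-1}x` (for `n ≥ 3`, its other end is `0100⋯0` or `1000⋯0`, which ends
in `0`). -/
noncomputable def GEdge.tgt {n : ℕ} (d : GEdge n) : GVert n :=
  if h : IsInterior n (act d.gen.state d.word) then GVert.inner (act d.gen.state d.word) h
  else GVert.x

/-- The graph `G_n`. -/
noncomputable def graphG (n : ℕ) : LGraph where
  V := GVert n
  E := GEdge n
  src := GEdge.src
  tgt := GEdge.tgt
  lab := GEdge.gen

/-! ### The embeddings -/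

/-- The three possible steps of a blowup, named after the letters that they append. -/
inductive Step
  | one
  | zeroZero
  | zeroOne

/-- The letters appended to the interior words. -/
def Step.letters : Step → List Bool
  | Step.one => [true]
  | Step.zeroZero => [false, false]
  | Step.zeroOne => [false, true]

/-- The increase of the level. -/
def Step.len : Step → ℕ
  | Step.one => 1
  | Step.zeroZero => 2
  | Step.zeroOne => 2

theorem Step.length_letters (t : Step) : t.letters.length = t.len := by
  cases t <;> rfl

theorem IsInterior.append {n : ℕ} {w : List Bool} (h : IsInterior n w) (t : Step) :
    IsInterior (n + t.len) (w ++ t.letters) := by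
  obtain ⟨hl, u, j, rfl⟩ := h
  refine ⟨by rw [List.length_append, hl, t.length_letters], ?_⟩
  cases t with
  | one => exact ⟨u ++ true :: zeros (2 * j), 0, rfl⟩
  | zeroZero =>
    refine ⟨u, j + 1, ?_⟩
    simp [Step.letters, zeros, Nat.mul_add, List.replicate_succ']
  | zeroOne => exact ⟨u ++ true :: zeros (2 * j) ++ [false], 0, by simp [Step.letters, zeros]⟩

theorem isInterior_zeros_one (n : ℕ) : IsInterior (n + 1) (zeros n ++ [true]) :=
  ⟨by simp [zeros], zeros n, 0, rfl⟩

theorem isInterior_zeros_zeroOne (n : ℕ) : IsInterior (n + 2) (zeros n ++ [false, true]) :=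
  ⟨by simp [zeros], zeros n ++ [false], 0, by simp [zeros]⟩

/-- The map `ι` on vertices. Note that `0^{n-1}01 = 0^n 1` and `0^{n-1}001 = 0^n 01`. -/
def stepV (n : ℕ) : (t : Step) → GVert n → GVert (n + t.len)
  | t, GVert.inner w h => GVert.inner (w ++ t.letters) (h.append t)
  | Step.one, GVert.x => GVert.inner (zeros n ++ [true]) (isInterior_zeros_one n)
  | Step.one, GVert.y => GVert.inner (zeros n ++ [true]) (isInterior_zeros_one n)
  | Step.zeroZero, GVert.x => GVert.x
  | Step.zeroZero, GVert.y => GVert.inner (zeros n ++ [false, true]) (isInterior_zeros_zeroOne n)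
  | Step.zeroOne, GVert.x => GVert.inner (zeros n ++ [false, true]) (isInterior_zeros_zeroOne n)
  | Step.zeroOne, GVert.y => GVert.y

/-- The word of the Schreier graph from which a vertex of `G_n` comes. -/
def GVert.addr {n : ℕ} : GVert n → List Bool
  | GVert.inner w _ => w
  | GVert.x => zeros n
  | GVert.y => zeros n

theorem act_append (s : State) (u t : List Bool) :
    act s (u ++ t) = act s u ++ act (after s u) t := by
  induction u generalizing s with
  | nil => rfl
  | cons c u ih => simp [act, after, ih]

theorem act_e (w : List Bool) : act State.e w = w := by
  induction w with
  | nil => rfl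
  | cons c w ih => simp [act, out, trans, ih]

theorem after_append (s : State) (u t : List Bool) :
    after s (u ++ t) = after (after s u) t := by
  induction u generalizing s with
  | nil => rfl
  | cons c u ih => simp [after, ih]

theorem after_e (w : List Bool) : after State.e w = State.e := by
  induction w with
  | nil => rfl
  | cons c w ih => simpa [after, trans] using ih

theorem zeros_not_isInterior (n m : ℕ) : ¬ IsInterior n (zeros m) := by
  rintro ⟨-, u, j, h⟩
  have : true ∈ zeros m := by rw [h]; simp
  simp [zeros] at this

theorem IsInterior.after_eq {n : ℕ} {w : List Bool} (h : IsInterior n w) (s : State) :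
    after s w = State.e := by
  obtain ⟨-, u, j, rfl⟩ := h
  rw [after_append, after]
  have : trans (after s u) true = State.e := by cases after s u <;> rfl
  rw [this, after_e]

theorem after_zeros_ne (s : Gen) (m : ℕ) : after s.state (zeros m) ≠ State.e := by
  induction m with
  | zero => cases s <;> simp [zeros, after, Gen.state]
  | succ m ih =>
    rw [zeros, List.replicate_succ', after_append]
    change after (after s.state (zeros m)) [false] ≠ State.e
    revert ih
    cases after s.state (zeros m) <;> simp [after, trans]

theorem not_isInterior_ten (n : ℕ) (u : List Bool) : ¬ IsInterior n (u ++ [true, false]) := by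
  rintro ⟨-, v, j, h⟩
  have h' := congrArg List.reverse h
  simp only [List.reverse_append, List.reverse_cons, zeros, List.reverse_replicate,
    List.append_assoc] at h'
  rcases j with _ | _ | j
  · simp at h'
  · simp [List.replicate_succ] at h'
  · simp [Nat.mul_add, List.replicate_succ] at h'

theorem after_zeros_of_isInterior {n : ℕ} {s : Gen} (h : IsInterior n (act s.state (zeros n))) :
    after s.state (zeros n) = State.a := by
  rcases n with _ | _ | m
  · exact absurd h (zeros_not_isInterior 0 0)
  · cases s with
    | a => exact absurd h (zeros_not_isInterior 1 1)
    | b => rfl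
  · have hz : zeros (m + 1 + 1) = zeros m ++ [false, false] := by
      simp [zeros, List.replicate_succ']
    rw [hz, act_append] at h
    rw [hz, after_append]
    have hm := after_zeros_ne s m
    revert hm h
    cases after s.state (zeros m) with
    | e => intro _ h; exact absurd rfl h
    | a => intro _ _; rfl
    | b => intro h _; exact absurd h (not_isInterior_ten _ _)

/-- Every edge of `G_n` issues from an interior word, or from `0^n` to an interior word. -/
theorem GEdge.cases {n : ℕ} (d : GEdge n) : IsInterior n d.word ∨
    (d.word = zeros n ∧ IsInterior n (act d.gen.state d.word)) := by
  rcases d.isEdge with h | h | h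
  · exact Or.inl h.1
  · exact Or.inl h.1
  · exact Or.inr h

theorem GEdge.src_inner {n : ℕ} (d : GEdge n) (h : IsInterior n d.word) :
    d.src = GVert.inner d.word h := dif_pos h

theorem GEdge.src_y {n : ℕ} (d : GEdge n) (h : d.word = zeros n) : d.src = GVert.y :=
  dif_neg (by rw [h]; exact zeros_not_isInterior n n)

theorem GEdge.tgt_inner {n : ℕ} (d : GEdge n) {w : List Bool} (h : IsInterior n w)
    (hw : act d.gen.state d.word = w) : d.tgt = GVert.inner w h := by
  subst hw
  exact dif_pos h

theorem GEdge.tgt_x {n : ℕ} (d : GEdge n) (h : act d.gen.state d.word = zeros n) :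
    d.tgt = GVert.x :=
  dif_neg (by rw [h]; exact zeros_not_isInterior n n)

/-- What the generator of an edge does to the image under `ι` of the initial vertex. -/
theorem stepE_aux {n : ℕ} (t : Step) (d : GEdge n) :
    act d.gen.state (stepV n t d.src).addr = (stepV n t d.tgt).addr := by
  rcases d.isEdge with ⟨h₁, h₂⟩ | ⟨h₁, h₂⟩ | ⟨h₁, h₂⟩
  · rw [d.src_inner h₁, d.tgt_inner h₂ rfl]
    simp only [stepV, GVert.addr, act_append, h₁.after_eq, act_e]
  · rw [d.src_inner h₁, d.tgt_x h₂]
    cases t <;>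
      simp [stepV, GVert.addr, act_append, h₁.after_eq, act_e, h₂, Step.letters, Step.len, zeros,
        List.replicate_succ']
  · rw [d.src_y h₁, d.tgt_inner h₂ rfl]
    have ha : after d.gen.state (zeros n) = State.a := by
      rw [h₁] at h₂
      exact after_zeros_of_isInterior h₂
    have hz : zeros (n + 2) = zeros n ++ [false, false] := by
      simp [zeros, List.replicate_succ']
    cases t <;>
      simp [stepV, GVert.addr, act_append, ha, act, out, trans, h₁, Step.letters, Step.len, hz]

/-- The map `ι` on edges: the edge with label `s` from `p` goes to the edge with label `s` from the
image of `p`. -/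
noncomputable def stepE (n : ℕ) (t : Step) (d : GEdge n) : GEdge (n + t.len) where
  word := (stepV n t d.src).addr
  gen := d.gen
  isEdge := by
    rw [stepE_aux t d]
    rcases d.isEdge with ⟨h₁, h₂⟩ | ⟨h₁, h₂⟩ | ⟨h₁, h₂⟩
    · rw [d.src_inner h₁, d.tgt_inner h₂ rfl]
      exact Or.inl ⟨h₁.append t, h₂.append t⟩
    · rw [d.src_inner h₁, d.tgt_x h₂]
      cases t
      · exact Or.inl ⟨h₁.append _, isInterior_zeros_one n⟩
      · exact Or.inr (Or.inl ⟨h₁.append _, rfl⟩)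
      · exact Or.inl ⟨h₁.append _, isInterior_zeros_zeroOne n⟩
    · rw [d.src_y h₁, d.tgt_inner h₂ rfl]
      cases t
      · exact Or.inl ⟨isInterior_zeros_one n, h₂.append _⟩
      · exact Or.inl ⟨isInterior_zeros_zeroOne n, h₂.append _⟩
      · exact Or.inr (Or.inr ⟨rfl, h₂.append _⟩)

/-- `ι` is a graph morphism: it respects initial vertices. -/
theorem src_stepE {n : ℕ} (t : Step) (d : GEdge n) : (stepE n t d).src = stepV n t d.src := by
  generalize hp : stepV n t d.src = p
  have hw : (stepE n t d).word = p.addr := by rw [← hp]; rfl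
  cases p with
  | inner w h =>
    simp only [GEdge.src, hw, GVert.addr, h, dif_pos]
  | y => exact GEdge.src_y _ hw
  | x =>
    exfalso
    rcases d.cases with h | h
    · rw [d.src_inner h] at hp; cases t <;> cases hp
    · rw [d.src_y h.1] at hp; cases t <;> cases hp

/-- `ι` is a graph morphism: it respects terminal vertices. -/
theorem tgt_stepE {n : ℕ} (t : Step) (d : GEdge n) : (stepE n t d).tgt = stepV n t d.tgt := by
  have hw : act (stepE n t d).gen.state (stepE n t d).word = (stepV n t d.tgt).addr :=
    stepE_aux t d
  generalize hp : stepV n t d.tgt = p at hw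
  cases p with
  | inner w h => exact GEdge.tgt_inner _ h hw
  | x => exact GEdge.tgt_x _ hw
  | y =>
    exfalso
    rcases d.isEdge with ⟨h₁, h₂⟩ | ⟨h₁, h₂⟩ | ⟨h₁, h₂⟩
    · rw [d.tgt_inner h₂ rfl] at hp; cases t <;> cases hp
    · rw [d.tgt_x h₂] at hp; cases t <;> cases hp
    · rw [d.tgt_inner h₂ rfl] at hp; cases t <;> cases hp

/-! ### Infinite blowups -/

/-- The direct limit, in the category of sets, of a sequence `F 0 → F 1 → F 2 → ⋯`. -/
def SeqLim (F : ℕ → Type) (f : ∀ n, F n → F (n + 1)) : Type :=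
  Quot fun p q : Σ n, F n => q = ⟨p.1 + 1, f p.1 p.2⟩

/-- The canonical map to the direct limit. -/
def SeqLim.of {F : ℕ → Type} {f : ∀ n, F n → F (n + 1)} (n : ℕ) (p : F n) : SeqLim F f :=
  Quot.mk _ ⟨n, p⟩

/-- The map of direct limits induced by a map of sequences. -/
def SeqLim.map {F G : ℕ → Type} {f : ∀ n, F n → F (n + 1)} {g : ∀ n, G n → G (n + 1)}
    (φ : ∀ n, F n → G n) (h : ∀ n p, φ (n + 1) (f n p) = g n (φ n p)) :
    SeqLim F f → SeqLim G g :=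
  Quot.lift (fun p => SeqLim.of p.1 (φ p.1 p.2)) (by
    rintro ⟨n, p⟩ _ rfl
    change SeqLim.of n (φ n p) = SeqLim.of (n + 1) (φ (n + 1) (f n p))
    rw [h]
    exact Quot.sound rfl)

/-- The map out of a direct limit given by a compatible family of maps. -/
def SeqLim.desc {F : ℕ → Type} {f : ∀ n, F n → F (n + 1)} {X : Type}
    (φ : ∀ n, F n → X) (h : ∀ n p, φ (n + 1) (f n p) = φ n p) : SeqLim F f → X :=
  Quot.lift (fun p => φ p.1 p.2) (by
    rintro ⟨n, p⟩ _ rfl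
    exact (h n p).symm)

/-- The levels of the blowup given by the sequence of steps `c`; they start with `2`. -/
def level (c : ℕ → Step) : ℕ → ℕ
  | 0 => 2
  | n + 1 => level c n + (c n).len

/-- The vertices of `G_∞`. -/
abbrev BlowupV (c : ℕ → Step) : Type :=
  SeqLim (fun n => GVert (level c n)) (fun n => stepV (level c n) (c n))

/-- The edges of `G_∞`. -/
abbrev BlowupE (c : ℕ → Step) : Type :=
  SeqLim (fun n => GEdge (level c n)) (fun n => stepE (level c n) (c n))

/-- The infinite blowup `G_∞` given by the sequence of steps `c`: the direct limit of the graphs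
`G_{level c n}` along the graph morphisms `ι`. -/
noncomputable def blowup (c : ℕ → Step) : LGraph where
  V := BlowupV c
  E := BlowupE c
  src := SeqLim.map (fun _ => GEdge.src) (fun n d => src_stepE (c n) d)
  tgt := SeqLim.map (fun _ => GEdge.tgt) (fun n d => tgt_stepE (c n) d)
  lab := SeqLim.desc (fun _ => GEdge.gen) (fun _ _ => rfl)

/-- The blowup has a boundary point: a vertex of `G_∞` all of whose representatives are boundary
vertices. -/
def HasBoundaryPoint (c : ℕ → Step) : Prop :=
  ∃ p : BlowupV c, ∀ (n : ℕ) (q : GVert (level c n)), SeqLim.of n q = p → q.IsBoundary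

end Basilica

/-! A generator acts trivially beyond the first letter `1` that it reads. Hence it changes only
finitely many letters of any word except `0^ω`, which `a` and `b` send to the two alternating words.
Together with self-replication this determines the orbits: that of `0^ω` consists of the eventually
zero and the eventually alternating words (`mem_orbit_zero_iff`), and every other orbit is a
cofinality class (`mem_orbit_iff`).

Ends are bounded above through `HasSmallCuts`: a connected graph in which every finite set lies in a
finite set with at most `k` outer neighbours has at most `k` ends. A word outside the orbit of `0^ω`
has infinitely many letters `1`, and fixing the tail that starts at one of them gives a set with two
outer neighbours; so its graph has at most two ends. In the graph of `0^ω` four outer neighbours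
suffice, and `0^ω` is a cut vertex with a neighbour in each of four infinite branches (`branch`).
This graph therefore has exactly four ends, and it is the exceptional one.

The blocks `1`, `00`, `01` form a complete prefix code, so sequences of steps correspond to the
tails of infinite words from position 2 on (`Follows`). A boundary point exists exactly when the
steps are eventually all `00` or eventually all `01`, which says that the word is exceptional
(`Follows.exceptional_iff`). Without boundary points, completing each interior word by the remaining
tail of the infinite word is a labelled isomorphism onto the Schreier graph
(`blowup_isLabelledIso`). A boundary point is incident to at most one edge, whereas every vertex of
a Schreier graph is the source of two; this excludes the remaining blowups. -/

namespace SimpleGraph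

/-! ### Counting the ends of a graph by finite cuts -/

open CategoryTheory

variable {V : Type} {G : SimpleGraph V}

/-- Every finite set of vertices is contained in a finite set with at most `k` outer neighbours. -/
def HasSmallCuts (G : SimpleGraph V) (k : ℕ) : Prop :=
  ∀ F : Finset V, ∃ K N : Finset V, F ⊆ K ∧ N.card ≤ k ∧ ∀ x ∉ K, ∀ y ∈ K, G.Adj x y → x ∈ N

theorem HasSmallCuts.of_iso {W : Type} {H : SimpleGraph W} {k : ℕ} (h : G.HasSmallCuts k)
    (f : G ≃g H) : H.HasSmallCuts k := by
  intro F
  obtain ⟨K, N, hK, hN, hadj⟩ := h (F.map f.symm.toEquiv.toEmbedding)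
  refine ⟨K.map f.toEquiv.toEmbedding, N.map f.toEquiv.toEmbedding, ?_, by simpa using hN, ?_⟩
  · intro x hx
    have : f.symm x ∈ K := hK (Finset.mem_map_of_mem f.symm.toEquiv.toEmbedding hx)
    exact Finset.mem_map.2 ⟨f.symm x, this, f.apply_symm_apply x⟩
  · intro x hx y hy hxy
    obtain ⟨y, hy', rfl⟩ := Finset.mem_map.1 hy
    refine Finset.mem_map.2 ⟨f.symm x, hadj _ ?_ y hy' ?_, f.apply_symm_apply x⟩
    · exact fun h => hx (Finset.mem_map.2 ⟨_, h, f.apply_symm_apply x⟩)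
    · rw [← f.map_adj_iff, f.apply_symm_apply]
      exact hxy

/-- Components of the complement of a finite set at which two ends differ stay different in the
complement of a larger set. -/
theorem end_apply_ne_of_subset {s t : G.end} {K L : Finset V} (h : K ⊆ L)
    (hne : s.1 (Opposite.op K) ≠ t.1 (Opposite.op K)) :
    s.1 (Opposite.op L) ≠ t.1 (Opposite.op L) := by
  intro heq
  apply hne
  have f : Opposite.op L ⟶ Opposite.op K := opHomOfLE h
  rw [← s.2 f, ← t.2 f, heq]

/-- Finitely many ends are pairwise separated by one finite set, which may be enlarged to a nonempty
`K` with at most `k` outer neighbours. By connectedness every component of the complement of `K`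
contains an outer neighbour, so there are at most `k` components to choose from. -/
theorem HasSmallCuts.not_injective [Nonempty V] (hG : G.Preconnected) {k : ℕ}
    (h : G.HasSmallCuts k) (f : Fin (k + 1) → G.end) : ¬ Function.Injective f := by
  classical
  intro hf
  have hex : ∀ p : Fin (k + 1) × Fin (k + 1), ∃ K : Finset V, p.1 ≠ p.2 →
      (f p.1).1 (Opposite.op K) ≠ (f p.2).1 (Opposite.op K) := by
    intro p
    by_cases hp : p.1 = p.2
    · exact ⟨∅, fun h => absurd hp h⟩
    · by_contra! hc
      refine hp (hf (Subtype.ext (funext fun K => ?_)))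
      exact (hc K.unop).2
  choose F hF using hex
  obtain ⟨K, N, hK, hN, hadj⟩ := h ({Classical.arbitrary V} ∪ Finset.univ.biUnion F)
  have hKne : (K : Set V).Nonempty :=
    ⟨Classical.arbitrary V, hK (Finset.mem_union_left _ (Finset.mem_singleton_self _))⟩
  have hb : ∀ C : G.ComponentCompl (K : Set V), ∃ x ∈ N, x ∈ C := by
    intro C
    obtain ⟨⟨c, d⟩, hc, hd, hcd⟩ := C.exists_adj_boundary_pair hG hKne
    exact ⟨c, hadj c (ComponentCompl.notMem_of_mem hc) d hd hcd, hc⟩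
  choose g hgN hg using hb
  have hginj : Function.Injective fun i => g ((f i).1 (Opposite.op K)) := by
    intro i j hij
    by_contra hne
    refine end_apply_ne_of_subset (G := G) (?_ : F (i, j) ⊆ K) (hF (i, j) hne) ?_
    · exact fun x hx => hK (Finset.mem_union_right _
        (Finset.mem_biUnion.2 ⟨(i, j), Finset.mem_univ _, hx⟩))
    · have hi := hg ((f i).1 (Opposite.op K))
      rw [show g ((f i).1 (Opposite.op K)) = g ((f j).1 (Opposite.op K)) from hij] at hi
      obtain ⟨h₁, h₁'⟩ := hi
      obtain ⟨h₂, h₂'⟩ := hg ((f j).1 (Opposite.op K))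
      exact h₁'.symm.trans h₂'
  have := Finset.card_le_card_of_injOn _ (s := Finset.univ) (t := N)
    (fun i _ => hgN ((f i).1 (Opposite.op K))) hginj.injOn
  simp at this
  omega

theorem HasSmallCuts.card_end_ne [Nonempty V] (hG : G.Preconnected) {k m : ℕ}
    (h : G.HasSmallCuts k) (hm : k < m) : Nat.card G.end ≠ m := by
  intro hc
  have hfin : Finite G.end := Nat.finite_of_card_ne_zero (by omega)
  let e := (Finite.equivFinOfCardEq hc).symm
  exact h.not_injective hG (fun i => e (Fin.castLE hm i))
    (e.injective.comp (Fin.castLE_injective hm))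

/-- Every infinite component of the complement of a finite set is chosen by some end. -/
theorem exists_end_apply_eq [LocallyFinite G] [Fact G.Preconnected] [Infinite V] (K : Finset V)
    (C : G.ComponentCompl (K : Set V)) (hC : C.supp.Infinite) :
    ∃ e : G.end, e.1 (Opposite.op K) = C := by
  -- Each finite set leaves finitely many components, so the inverse system is Mittag-Leffler and
  -- its eventual ranges have surjective transition maps. Every element of an eventual range thus
  -- extends to a section, and the infinite components are exactly these elements.
  have hML : G.componentComplFunctor.IsMittagLeffler :=
    Functor.isMittagLeffler_of_exists_finite_range _ fun j =>
      ⟨j, 𝟙 j, Set.toFinite _⟩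
  have : ∀ j, Nonempty (G.componentComplFunctor.toEventualRanges.obj j) :=
    Functor.toEventualRanges_nonempty _ hML
  have hmem := (infinite_iff_in_eventualRange G (K := Opposite.op K) C).1 hC
  obtain ⟨s, hs⟩ := Functor.eval_section_surjective_of_surjective
    G.componentComplFunctor.toEventualRanges (Functor.surjective_toEventualRanges _ hML)
    (Opposite.op K) ⟨C, hmem⟩
  refine ⟨Functor.toEventualRangesSectionsEquiv _ s, ?_⟩
  exact congrArg Subtype.val hs

/-- A cut vertex `z` with `k` neighbours lying in different fibres of a function that is locally
constant away from `z` gives `k` different ends, provided that the fibres are infinite. -/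
theorem exists_injective_end [LocallyFinite G] [Fact G.Preconnected] [Infinite V] {ι : Type}
    (z : V) (f : V → ι) (hf : ∀ x y, x ≠ z → y ≠ z → G.Adj x y → f x = f y)
    (nb : ι → V) (hnb : ∀ i, f (nb i) = i) (hnz : ∀ i, nb i ≠ z)
    (hadj : ∀ x, G.Adj x z → ∃ i, x = nb i)
    (hinf : ∀ i, {x | x ≠ z ∧ f x = i}.Infinite) :
    ∃ e : ι → G.end, Function.Injective e := by
  let K : Finset V := {z}
  have hK : ∀ {x}, x ≠ z → x ∉ (K : Set V) := fun h => by simpa [K] using h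
  have hK' : ∀ {x}, x ∉ (K : Set V) → x ≠ z := fun h => by simpa [K] using h
  let φ : G.ComponentCompl (K : Set V) → ι :=
    ComponentCompl.lift (fun v _ => f v) fun v w hv hw h => hf v w (hK' hv) (hK' hw) h
  let C : ι → G.ComponentCompl (K : Set V) := fun i => G.componentComplMk (hK (hnz i))
  have hφ : ∀ i, φ (C i) = i := hnb
  have hC : ∀ i, (C i).supp.Infinite := by
    intro i
    refine (hinf i).mono ?_
    rintro x ⟨hxz, hx⟩
    -- The component of `x` must touch `z`, and does so at some `nb j`. Since `f` is constant on
    -- components, `j = i`: the whole fibre lies in the single component `C i`.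
    obtain ⟨⟨c, d⟩, hc, hd, hcd⟩ := ComponentCompl.exists_adj_boundary_pair
      (Fact.out : G.Preconnected) (⟨z, by simp [K]⟩ : (K : Set V).Nonempty)
      (G.componentComplMk (hK hxz))
    have hdz : d = z := by simpa [K] using hd
    subst hdz
    obtain ⟨j, rfl⟩ := hadj c hcd
    obtain ⟨h₁, h₂⟩ := hc
    have hji : j = i := by
      rw [← hφ j, ← hx]
      exact congrArg φ h₂
    subst hji
    exact ⟨hK hxz, h₂.symm⟩
  choose e he using fun i => exists_end_apply_eq K (C i) (hC i)
  refine ⟨e, fun i j hij => ?_⟩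
  rw [← hφ i, ← hφ j, ← he i, ← he j, hij]

theorem HasSmallCuts.card_end_eq [Nonempty V] (hG : G.Preconnected) {k : ℕ}
    (h : G.HasSmallCuts k) (e : Fin k → G.end) (he : Function.Injective e) :
    Nat.card G.end = k := by
  -- `Nat.card` is `0` on infinite types, so finiteness has to be settled before counting.
  have hfin : Finite G.end := by
    by_contra hinf
    rw [not_finite_iff_infinite] at hinf
    exact h.not_injective hG _ ((Infinite.natEmbedding G.end).injective.comp Fin.val_injective)
  refine le_antisymm ?_ ?_
  · by_contra! hlt
    let e' := (Finite.equivFin G.end).symm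
    exact h.not_injective hG (fun i => e' (Fin.castLE hlt i))
      (e'.injective.comp (Fin.castLE_injective hlt))
  · simpa using Nat.card_le_card_of_injective e he

end SimpleGraph

namespace Basilica

/-! ### Infinite words -/

/-- The infinite word obtained from `t` by prepending the letter `c`. -/
def cons (c : Bool) (t : Word) : Word
  | 0 => c
  | n + 1 => t n

/-- The infinite word obtained from `v` by deleting the first `n` letters. -/
def drop (n : ℕ) (v : Word) : Word := fun i => v (n + i)

/-- The infinite word obtained from `t` by prepending the finite word `w`. -/
def app : List Bool → Word → Word
  | [], t => t
  | c :: w, t => cons c (app w t)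

/-- The word `0^ω`. -/
def zero : Word := fun _ => false

/-- The word `0^n t`. -/
def pad (n : ℕ) (t : Word) : Word := fun i => if i < n then false else t (i - n)

theorem cons_drop_one (v : Word) : cons (v 0) (drop 1 v) = v := by
  funext i
  cases i with
  | zero => rfl
  | succ i => simp [cons, drop, Nat.add_comm]

theorem drop_drop (m n : ℕ) (v : Word) : drop m (drop n v) = drop (n + m) v := by
  funext i
  simp [drop, Nat.add_assoc]

theorem drop_zero (v : Word) : drop 0 v = v := by
  funext i
  simp [drop]

theorem drop_congr_of_le {m n : ℕ} (h : m ≤ n) {u v : Word} (he : drop m u = drop m v) :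
    drop n u = drop n v := by
  obtain ⟨k, rfl⟩ := Nat.exists_eq_add_of_le h
  rw [← drop_drop, ← drop_drop, he]

theorem drop_app (w : List Bool) (t : Word) : drop w.length (app w t) = t := by
  induction w with
  | nil => funext i; simp [drop, app]
  | cons c w ih =>
    rw [List.length_cons, Nat.add_comm, ← drop_drop]
    have : drop 1 (app (c :: w) t) = app w t := by
      funext i
      simp [drop, app, cons, Nat.add_comm 1 i]
    rw [this, ih]

theorem app_append (u w : List Bool) (t : Word) : app (u ++ w) t = app u (app w t) := by
  induction u with
  | nil => rfl
  | cons c u ih => simp [app, ih]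

theorem cons_injective {c c' : Bool} {t t' : Word} (h : cons c t = cons c' t') :
    c = c' ∧ t = t' :=
  ⟨congrFun h 0, funext fun n => congrFun h (n + 1)⟩

theorem app_injective {w w' : List Bool} {t t' : Word} (hl : w.length = w'.length)
    (h : app w t = app w' t') : w = w' ∧ t = t' := by
  induction w generalizing w' with
  | nil => cases w' with
    | nil => exact ⟨rfl, h⟩
    | cons c w' => simp at hl
  | cons c w ih => cases w' with
    | nil => simp at hl
    | cons c' w' =>
      obtain ⟨rfl, h'⟩ := cons_injective h
      obtain ⟨rfl, rfl⟩ := ih (by simpa using hl) h'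
      exact ⟨rfl, rfl⟩

theorem exists_app_drop (n : ℕ) (v : Word) :
    ∃ w : List Bool, w.length = n ∧ v = app w (drop n v) := by
  induction n generalizing v with
  | zero => exact ⟨[], rfl, by funext i; simp [app, drop]⟩
  | succ n ih =>
    obtain ⟨w, hw, h⟩ := ih (drop 1 v)
    refine ⟨v 0 :: w, by simp [hw], ?_⟩
    rw [app, Nat.add_comm n 1, ← drop_drop, ← h, cons_drop_one]

theorem eq_pad {n : ℕ} {v : Word} (h : ∀ i < n, v i = false) : v = pad n (drop n v) := by
  funext i
  unfold pad drop
  split_ifs with hi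
  · exact h i hi
  · congr 1; omega

theorem pad_zero (n : ℕ) : pad n zero = zero := by
  funext i
  simp [pad, zero]

theorem drop_zero_word (n : ℕ) : drop n zero = zero := rfl

theorem finite_setOf_drop_eq (n : ℕ) (t : Word) : {u : Word | drop n u = t}.Finite := by
  refine (Set.finite_range fun (w : Fin n → Bool) (i : ℕ) =>
    if h : i < n then w ⟨i, h⟩ else t (i - n)).subset ?_
  rintro u rfl
  refine ⟨fun i => u i, ?_⟩
  funext i
  by_cases hi : i < n
  · simp [hi]
  · simp only [hi, dite_false, drop]
    congr 1; omega

/-! ### The automaton on infinite words -/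

/-- The source of all locality: the letter `1` leads every state to the identity, so a generator can
act on a tail only through a prefix of zeros. -/
theorem trans_true (s : State) : trans s true = State.e := by cases s <;> rfl

theorem stateAt_add (s : State) (v : Word) (n i : ℕ) :
    stateAt s v (n + i) = stateAt (stateAt s v n) (drop n v) i := by
  induction i with
  | zero => rfl
  | succ i ih =>
    rw [← Nat.add_assoc, stateAt, stateAt, ih]
    rfl

theorem stateAt_e (v : Word) (n : ℕ) : stateAt State.e v n = State.e := by
  induction n with
  | zero => rfl
  | succ n ih => rw [stateAt, ih]; rfl

theorem actInf_e (v : Word) : actInf State.e v = v := by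
  funext n
  rw [actInf, stateAt_e]
  rfl

theorem drop_actInf (s : State) (v : Word) (n : ℕ) :
    drop n (actInf s v) = actInf (stateAt s v n) (drop n v) := by
  funext i
  simp only [drop, actInf, stateAt_add]

theorem actInf_cons (s : State) (c : Bool) (t : Word) :
    actInf s (cons c t) = cons (out s c) (actInf (trans s c) t) := by
  rw [← cons_drop_one (actInf s (cons c t)), drop_actInf]
  have h : drop 1 (cons c t) = t := by
    funext i
    simp [drop, Nat.add_comm 1 i, cons]
  rw [h]
  rfl

theorem actInf_app (s : State) (w : List Bool) (t : Word) :
    actInf s (app w t) = app (act s w) (actInf (after s w) t) := by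
  induction w generalizing s with
  | nil => rfl
  | cons c w ih => simp [app, act, after, actInf_cons, ih]

theorem stateAt_eq_e {s : State} {v : Word} {k n : ℕ} (hk : v k = true) (hn : k < n) :
    stateAt s v n = State.e := by
  obtain ⟨j, rfl⟩ := Nat.exists_eq_add_of_lt hn
  rw [show k + j + 1 = (k + 1) + j by omega, stateAt_add, stateAt, hk, trans_true, stateAt_e]

theorem drop_actInf_of_true {v : Word} {k n : ℕ} (s : State) (hk : v k = true) (hn : k < n) :
    drop n (actInf s v) = drop n v := by
  rw [drop_actInf, stateAt_eq_e hk hn, actInf_e]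

theorem actInf_actInfInv (s : State) (v : Word) : actInf s (actInfInv s v) = v :=
  (actPerm s).right_inv v

theorem actInfInv_actInf (s : State) (v : Word) : actInfInv s (actInf s v) = v :=
  (actPerm s).left_inv v

theorem actInf_a_of_true {t : Word} (h : t 0 = true) : actInf State.a t = t := by
  conv_lhs => rw [← cons_drop_one t, h, actInf_cons]
  rw [trans_true, actInf_e, out, ← h, cons_drop_one]

theorem actInfInv_a_of_true {t : Word} (h : t 0 = true) : actInfInv State.a t = t := by
  conv_lhs => rw [← actInf_a_of_true h]
  exact actInfInv_actInf _ _

/-- The other generator. -/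
def Gen.swap : Gen → Gen
  | Gen.a => Gen.b
  | Gen.b => Gen.a

theorem Gen.swap_involutive : Function.Involutive Gen.swap := by
  intro s
  cases s <;> rfl

theorem trans_false (s : Gen) : trans s.state false = s.swap.state := by cases s <;> rfl

theorem stateAt_of_zeros {v : Word} {n : ℕ} (h : ∀ i < n, v i = false) (s : Gen) :
    stateAt s.state v n = (Gen.swap^[n] s).state := by
  induction n with
  | zero => rfl
  | succ n ih =>
    rw [stateAt, ih fun i hi => h i (by omega), h n (by omega), trans_false,
      Function.iterate_succ_apply']

/-- A generator changes the tail of a word only if the head consists of zeros. -/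
theorem drop_actInf_cases (s : Gen) (u : Word) (n : ℕ) :
    drop n (actInf s.state u) = drop n u ∨
      ∃ t : Gen, s = Gen.swap^[n] t ∧ u = pad n (drop n u) ∧
        drop n (actInf s.state u) = actInf t.state (drop n u) := by
  by_cases h : ∀ i < n, u i = false
  · refine Or.inr ⟨Gen.swap^[n] s, ?_, eq_pad h, ?_⟩
    · exact (Function.LeftInverse.iterate Gen.swap_involutive n s).symm
    · rw [drop_actInf, stateAt_of_zeros h]
  · push Not at h
    obtain ⟨k, hk, hu⟩ := h
    exact Or.inl (drop_actInf_of_true _ (by simpa using hu) hk)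

/-! ### The orbits -/

theorem mem_orbit_comm {u v : Word} :
    u ∈ MulAction.orbit basilica v ↔ v ∈ MulAction.orbit basilica u :=
  MulAction.mem_orbit_symm

theorem mem_orbit_trans {u v w : Word} (h₁ : u ∈ MulAction.orbit basilica v)
    (h₂ : v ∈ MulAction.orbit basilica w) : u ∈ MulAction.orbit basilica w := by
  rwa [← MulAction.orbit_eq_iff.2 h₂]

theorem perm_apply_inv_self (g : Equiv.Perm Word) (v : Word) : g (g⁻¹ v) = v :=
  g.apply_symm_apply v

theorem actInf_mem_orbit (s : State) (v : Word) : actInf s v ∈ MulAction.orbit basilica v :=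
  actPerm_orbit s (MulAction.mem_orbit_self v)

/-- Self-replication: on words beginning with `0`, the generator `a` acts as `b` on the tail, and
`b²` acts as `a` on the tail. So any motion of the tail lifts. -/
theorem cons_false_mem_orbit {u v : Word} (h : u ∈ MulAction.orbit basilica v) :
    cons false u ∈ MulAction.orbit basilica (cons false v) := by
  obtain ⟨⟨g, hg⟩, rfl⟩ := h
  change cons false (g v) ∈ _
  induction hg using Subgroup.closure_induction generalizing v with
  | mem g hg =>
    obtain ⟨s, rfl⟩ := hg
    change cons false (actInf s v) ∈ _
    cases s with
    | e => rw [actInf_e]; exact MulAction.mem_orbit_self _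
    | a =>
      have h : cons false (actInf State.a v) = actInf State.b (actInf State.b (cons false v)) := by
        have h' : actInf State.b (cons false v) = cons true (actInf State.a v) := actInf_cons _ _ _
        rw [h', actInf_cons, trans_true, actInf_e]
        rfl
      rw [h]
      exact mem_orbit_trans (actInf_mem_orbit _ _) (actInf_mem_orbit _ _)
    | b =>
      have h : cons false (actInf State.b v) = actInf State.a (cons false v) := by
        rw [actInf_cons]
        rfl
      rw [h]
      exact actInf_mem_orbit _ _
  | one => exact MulAction.mem_orbit_self _
  | mul g h _ _ ihg ihh => exact mem_orbit_trans (ihg (v := h v)) ihh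
  | inv g _ ih =>
    have := ih (v := g⁻¹ v)
    rw [perm_apply_inv_self] at this
    exact mem_orbit_comm.1 this

theorem cons_mem_orbit_cons_false (c : Bool) (v : Word) :
    cons c v ∈ MulAction.orbit basilica (cons false v) := by
  cases c with
  | false => exact MulAction.mem_orbit_self _
  | true =>
    have h : cons false v = actInf State.b (cons true v) := by
      rw [actInf_cons, trans_true, actInf_e]
      rfl
    rw [mem_orbit_comm, h]
    exact actInf_mem_orbit _ _

theorem cons_mem_orbit (c c' : Bool) {u v : Word} (h : u ∈ MulAction.orbit basilica v) :
    cons c u ∈ MulAction.orbit basilica (cons c' v) :=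
  mem_orbit_trans (cons_mem_orbit_cons_false c u) (mem_orbit_trans (cons_false_mem_orbit h)
    (mem_orbit_comm.1 (cons_mem_orbit_cons_false c' v)))

theorem mem_orbit_of_drop {n : ℕ} {u v : Word}
    (h : drop n u ∈ MulAction.orbit basilica (drop n v)) : u ∈ MulAction.orbit basilica v := by
  induction n generalizing u v with
  | zero => rwa [drop_zero, drop_zero] at h
  | succ n ih =>
    rw [Nat.add_comm n 1, ← drop_drop, ← drop_drop] at h
    rw [← cons_drop_one u, ← cons_drop_one v]
    exact cons_mem_orbit _ _ (ih h)

/-- Cofinal words lie in the same orbit. -/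
theorem mem_orbit_of_drop_eq {n : ℕ} {u v : Word} (h : drop n u = drop n v) :
    u ∈ MulAction.orbit basilica v :=
  mem_orbit_of_drop (n := n) (by rw [h]; exact MulAction.mem_orbit_self _)

/-- The words which are eventually zero. -/
def EventuallyZero (v : Word) : Prop := ∃ n, ∀ i ≥ n, v i = false

/-- The words which are eventually alternating. -/
def EventuallyAlternating (v : Word) : Prop := ∃ n, ∀ i ≥ n, v (i + 1) = !v i

/-- The words which are eventually zero or eventually alternating. -/
def Exceptional (v : Word) : Prop := EventuallyZero v ∨ EventuallyAlternating v

theorem apply_eq_of_drop_eq {n : ℕ} {u v : Word} (h : drop n u = drop n v) {i : ℕ} (hi : n ≤ i) :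
    u i = v i := by
  obtain ⟨k, rfl⟩ := Nat.exists_eq_add_of_le hi
  exact congrFun h k

theorem EventuallyZero.of_drop_eq {n : ℕ} {u v : Word} (h : drop n u = drop n v)
    (hu : EventuallyZero u) : EventuallyZero v := by
  obtain ⟨m, hm⟩ := hu
  refine ⟨max m n, fun i hi => ?_⟩
  rw [← apply_eq_of_drop_eq h (by omega), hm i (by omega)]

theorem EventuallyAlternating.of_drop_eq {n : ℕ} {u v : Word} (h : drop n u = drop n v)
    (hu : EventuallyAlternating u) : EventuallyAlternating v := by
  obtain ⟨m, hm⟩ := hu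
  refine ⟨max m n, fun i hi => ?_⟩
  rw [← apply_eq_of_drop_eq h (by omega), ← apply_eq_of_drop_eq h (by omega), hm i (by omega)]

theorem Exceptional.of_drop_eq {n : ℕ} {u v : Word} (h : drop n u = drop n v)
    (hu : Exceptional u) : Exceptional v :=
  hu.imp (·.of_drop_eq h) (·.of_drop_eq h)

theorem exceptional_zero : Exceptional zero := Or.inl ⟨0, fun _ _ => rfl⟩

theorem actInf_zero_succ (s : Gen) (i : ℕ) :
    actInf s.state zero (i + 1) = !actInf s.state zero i := by
  rw [actInf, actInf, stateAt_of_zeros (v := zero) (fun _ _ => rfl),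
    stateAt_of_zeros (v := zero) (fun _ _ => rfl),
    Function.iterate_succ_apply']
  cases Gen.swap^[i] s <;> rfl

theorem exists_true_of_ne_zero {v : Word} (h : v ≠ zero) : ∃ k, v k = true := by
  by_contra! hc
  exact h (funext fun i => by simpa [zero] using hc i)

/-- Both kinds of exceptional words are invariant under changes of finitely many letters. Only at
`0^ω` does a generator change more, and there it leads from one kind to the other. -/
theorem exceptional_actInf (s : State) (v : Word) : Exceptional (actInf s v) ↔ Exceptional v := by
  by_cases hv : v = zero
  · subst hv
    refine ⟨fun _ => exceptional_zero, fun _ => ?_⟩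
    cases s with
    | e => rw [actInf_e]; exact exceptional_zero
    | a => exact Or.inr ⟨0, fun i _ => actInf_zero_succ Gen.a i⟩
    | b => exact Or.inr ⟨0, fun i _ => actInf_zero_succ Gen.b i⟩
  · obtain ⟨k, hk⟩ := exists_true_of_ne_zero hv
    have h := drop_actInf_of_true s hk (Nat.lt_succ_self k)
    exact ⟨fun h' => h'.of_drop_eq h, fun h' => h'.of_drop_eq h.symm⟩

theorem exceptional_apply {g : Equiv.Perm Word} (hg : g ∈ basilica) (v : Word) :
    Exceptional (g v) ↔ Exceptional v := by
  induction hg using Subgroup.closure_induction generalizing v with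
  | mem g hg =>
    obtain ⟨s, rfl⟩ := hg
    exact exceptional_actInf s v
  | one => rfl
  | mul g h _ _ ihg ihh => exact (ihg (h v)).trans (ihh v)
  | inv g _ ih => rw [← ih, perm_apply_inv_self]

theorem alternating_eq {u v : Word} (hu : ∀ i, u (i + 1) = !u i) (hv : ∀ i, v (i + 1) = !v i)
    (h : u 0 = v 0) : u = v := by
  funext i
  induction i with
  | zero => exact h
  | succ i ih => rw [hu, hv, ih]

/-- A word which is eventually alternating has a tail `s (0^ω)`, for a generator `s`. -/
theorem drop_eq_actInf_zero {v : Word} {n : ℕ} (h : ∀ i ≥ n, v (i + 1) = !v i) :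
    ∃ s : Gen, drop n v = actInf s.state zero := by
  have h' : ∀ i, drop n v (i + 1) = !drop n v i := fun i => h (n + i) (by omega)
  cases h0 : drop n v 0 with
  | false => exact ⟨Gen.a, alternating_eq h' (actInf_zero_succ _) (by rw [h0]; rfl)⟩
  | true => exact ⟨Gen.b, alternating_eq h' (actInf_zero_succ _) (by rw [h0]; rfl)⟩

/-- The orbit of `0^ω`. -/
theorem mem_orbit_zero_iff {v : Word} : v ∈ MulAction.orbit basilica zero ↔ Exceptional v := by
  constructor
  · rintro ⟨⟨g, hg⟩, rfl⟩
    exact (exceptional_apply hg zero).2 exceptional_zero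
  · rintro (⟨n, hn⟩ | ⟨n, hn⟩)
    · exact mem_orbit_of_drop_eq (n := n) (funext fun i => hn (n + i) (by omega))
    · obtain ⟨s, hs⟩ := drop_eq_actInf_zero hn
      refine mem_orbit_of_drop (n := n) ?_
      rw [hs, drop_zero_word]
      exact actInf_mem_orbit _ _

/-- The exceptional words form an invariant set containing `0^ω`. Hence a product of generators
applied to a non-exceptional word never meets `0^ω`, and each factor changes only finitely many
letters. -/
theorem exists_drop_apply_eq {g : Equiv.Perm Word} (hg : g ∈ basilica) {v : Word}
    (hv : ¬ Exceptional v) : ∃ n, drop n (g v) = drop n v := by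
  induction hg using Subgroup.closure_induction generalizing v with
  | mem g hg =>
    obtain ⟨s, rfl⟩ := hg
    have hv0 : v ≠ zero := by
      rintro rfl
      exact hv exceptional_zero
    obtain ⟨k, hk⟩ := exists_true_of_ne_zero hv0
    exact ⟨k + 1, drop_actInf_of_true s hk (Nat.lt_succ_self k)⟩
  | one => exact ⟨0, rfl⟩
  | mul g h _ hh ihg ihh =>
    obtain ⟨n, hn⟩ := ihh hv
    obtain ⟨m, hm⟩ := ihg (v := h v) (by rwa [exceptional_apply hh])
    exact ⟨max m n, (drop_congr_of_le (le_max_left m n) hm).trans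
      (drop_congr_of_le (le_max_right m n) hn)⟩
  | inv g hg ih =>
    obtain ⟨n, hn⟩ := ih (v := g⁻¹ v)
      (by rwa [← exceptional_apply hg, perm_apply_inv_self])
    rw [perm_apply_inv_self] at hn
    exact ⟨n, hn.symm⟩

/-- Away from the orbit of `0^ω`, the orbits are the cofinality classes. -/
theorem mem_orbit_iff {u v : Word} (hv : ¬ Exceptional v) :
    u ∈ MulAction.orbit basilica v ↔ ∃ n, drop n u = drop n v := by
  constructor
  · rintro ⟨⟨g, hg⟩, rfl⟩
    exact exists_drop_apply_eq hg hv
  · rintro ⟨n, hn⟩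
    exact mem_orbit_of_drop_eq hn


/-! ### Ends of orbital Schreier graphs -/

theorem LGraph.toSimple_adj {G : LGraph} {p q : G.V} :
    G.toSimple.Adj p q ↔ p ≠ q ∧ ∃ e, s(G.src e, G.tgt e) = s(p, q) := by
  simp only [LGraph.toSimple, SimpleGraph.fromRel_adj, Sym2.eq_iff, exists_or]

/-- An isomorphism of multigraphs induces one of the simple graphs of adjacency. -/
theorem LGraph.IsIso.toSimple {G H : LGraph} (h : G.IsIso H) :
    Nonempty (G.toSimple ≃g H.toSimple) := by
  obtain ⟨f, g, hfg⟩ := h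
  refine ⟨⟨f, ?_⟩⟩
  intro p q
  rw [toSimple_adj, toSimple_adj, f.injective.ne_iff]
  refine and_congr_right fun _ => ?_
  rw [← g.exists_congr_right]
  refine exists_congr fun e => ?_
  rw [hfg]
  have := (Sym2.map.injective f.injective).eq_iff (a := s(G.src e, G.tgt e)) (b := s(p, q))
  simpa only [Sym2.map_mk] using this

theorem LGraph.IsIso.symm {G H : LGraph} (h : G.IsIso H) : H.IsIso G := by
  obtain ⟨f, g, hfg⟩ := h
  refine ⟨f.symm, g.symm, fun e => ?_⟩
  have := congrArg (Sym2.map f.symm) (hfg (g.symm e))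
  simpa using this.symm

theorem LGraph.IsIso.trans {G H K : LGraph} (h : G.IsIso H) (h' : H.IsIso K) : G.IsIso K := by
  obtain ⟨f, g, hfg⟩ := h
  obtain ⟨f', g', hfg'⟩ := h'
  refine ⟨f.trans f', g.trans g', fun e => ?_⟩
  have := congrArg (Sym2.map f') (hfg e)
  simpa [hfg'] using this

theorem schreier_adj {v : Word} {p q : MulAction.orbit basilica v} :
    (schreier v).toSimple.Adj p q ↔
      p ≠ q ∧ ∃ s : Gen, actInf s.state p.1 = q.1 ∨ actInf s.state q.1 = p.1 := by
  refine (LGraph.toSimple_adj (G := schreier v) (p := p) (q := q)).trans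
    (and_congr_right fun _ => ⟨?_, ?_⟩)
  · rintro ⟨⟨u, s⟩, he⟩
    rcases Sym2.eq_iff.1 he with ⟨h₁, h₂⟩ | ⟨h₁, h₂⟩
    · exact ⟨s, Or.inl (by rw [← h₁, ← h₂]; rfl)⟩
    · exact ⟨s, Or.inr (by rw [← h₁, ← h₂]; rfl)⟩
  · rintro ⟨s, h | h⟩
    · exact ⟨(p, s), Sym2.eq_iff.2 (Or.inl ⟨rfl, Subtype.ext h⟩)⟩
    · exact ⟨(q, s), Sym2.eq_iff.2 (Or.inr ⟨rfl, Subtype.ext h⟩)⟩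

theorem reachable_apply {v : Word} {g : Equiv.Perm Word} (hg : g ∈ basilica) {u : Word}
    (hu : u ∈ MulAction.orbit basilica v) (hgu : g u ∈ MulAction.orbit basilica v) :
    (schreier v).toSimple.Reachable ⟨u, hu⟩ ⟨g u, hgu⟩ := by
  induction hg using Subgroup.closure_induction generalizing u with
  | mem g hg =>
    obtain ⟨s, rfl⟩ := hg
    by_cases hne : u = actPerm s u
    · have : (⟨u, hu⟩ : MulAction.orbit basilica v) = ⟨actPerm s u, hgu⟩ := Subtype.ext hne
      exact this ▸ SimpleGraph.Reachable.refl _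
    · refine SimpleGraph.Adj.reachable (schreier_adj.2 ⟨fun h => hne (congrArg Subtype.val h), ?_⟩)
      cases s with
      | e => exact absurd (actInf_e u).symm hne
      | a => exact ⟨Gen.a, Or.inl rfl⟩
      | b => exact ⟨Gen.b, Or.inl rfl⟩
  | one => exact SimpleGraph.Reachable.refl _
  | mul g h _ hh ihg ihh =>
    have hm : h u ∈ MulAction.orbit basilica v :=
      mem_orbit_trans ⟨⟨h, hh⟩, rfl⟩ hu
    exact (ihh hu hm).trans (ihg hm hgu)
  | inv g _ ih =>
    have := ih (u := g⁻¹ u) hgu (by rwa [perm_apply_inv_self])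
    simp only [perm_apply_inv_self] at this
    exact this.symm

theorem schreier_preconnected (v : Word) : (schreier v).toSimple.Preconnected := by
  have h : ∀ q : MulAction.orbit basilica v, (schreier v).toSimple.Reachable
      (⟨v, MulAction.mem_orbit_self v⟩ : MulAction.orbit basilica v) q := by
    rintro ⟨_, ⟨g, hg⟩, rfl⟩
    exact reachable_apply hg _ _
  exact fun p q => (h p).symm.trans (h q)

theorem finite_neighborSet (v : Word) (p : (schreier v).V) :
    Finite ((schreier v).toSimple.neighborSet p) := by
  refine Set.Finite.to_subtype (Set.Finite.of_finite_image (f := Subtype.val)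
    ((Set.toFinite {actInf State.a p.1, actInf State.b p.1, actInfInv State.a p.1,
      actInfInv State.b p.1}).subset ?_) Subtype.val_injective.injOn)
  rintro _ ⟨q, hq, rfl⟩
  obtain ⟨-, s, h | h⟩ := schreier_adj.1 ((SimpleGraph.mem_neighborSet _ _ _).1 hq)
  · cases s
    · exact Or.inl h.symm
    · exact Or.inr (Or.inl h.symm)
  · have h' : q.1 = actInfInv s.state p.1 := by rw [← h, actInfInv_actInf]
    cases s
    · exact Or.inr (Or.inr (Or.inl h'))
    · exact Or.inr (Or.inr (Or.inr h'))

/-- A sequence of finite sets of words which exhausts the orbit and has at most `k` outer neighbours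
infinitely often gives small cuts. -/
theorem hasSmallCuts_of_exhaustion {v : Word} {k : ℕ} (K : ℕ → Set Word)
    (hfin : ∀ n, (K n).Finite)
    (hex : ∀ u ∈ MulAction.orbit basilica v, ∃ m, ∀ n ≥ m, u ∈ K n)
    (hout : ∀ m, ∃ n ≥ m, ∃ N : Finset Word, N.card ≤ k ∧ ∀ x ∉ K n, ∀ y ∈ K n, ∀ s : Gen,
      actInf s.state x = y ∨ actInf s.state y = x → x ∈ N) :
    (schreier v).toSimple.HasSmallCuts k := by
  classical
  intro F
  choose m hm using fun u : MulAction.orbit basilica v => hex u.1 u.2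
  obtain ⟨n, hn, N, hNk, hN⟩ := hout (Finset.sup F m)
  have hK : {u : MulAction.orbit basilica v | u.1 ∈ K n}.Finite :=
    (hfin n).preimage Subtype.val_injective.injOn
  refine ⟨hK.toFinset, N.preimage (Subtype.val : MulAction.orbit basilica v → Word)
    Subtype.val_injective.injOn, ?_, ?_, ?_⟩
  · intro u hu
    exact hK.mem_toFinset.2 (hm u n ((Finset.le_sup (f := m) hu).trans hn))
  · refine le_trans ?_ hNk
    refine Finset.card_le_card_of_injOn Subtype.val (fun x hx => ?_) Subtype.val_injective.injOn
    exact Finset.mem_preimage.1 hx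
  · intro x hx y hy hxy
    obtain ⟨-, s, hs⟩ := schreier_adj.1 hxy
    exact Finset.mem_preimage.2
      (hN x.1 (hK.mem_toFinset.not.1 hx) y.1 (hK.mem_toFinset.1 hy) s hs)

/-- If `t` begins with `1`, the words of the form `wt` with `|w| = n` have only two outer
neighbours. -/
theorem outer_neighbor_drop {n : ℕ} {t x y : Word} (ht : t 0 = true) (hx : drop n x ≠ t)
    (hy : drop n y = t) {s : Gen} (h : actInf s.state x = y ∨ actInf s.state y = x) :
    x = pad n (actInfInv State.b t) ∨
      x = actInf (Gen.swap^[n] Gen.b).state (pad n t) := by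
  rcases h with h | h
  · left
    rcases drop_actInf_cases s x n with h' | ⟨r, -, hpad, h'⟩
    · rw [h, hy] at h'
      exact absurd h'.symm hx
    · rw [h, hy] at h'
      have h'' : drop n x = actInfInv r.state t := by rw [h', actInfInv_actInf]
      -- The state `a` fixes `t`, which begins with `1`, so only the state `b` can lead out of the
      -- block; this gives one neighbour in each direction.
      cases r with
      | a => exact absurd (h''.trans (actInfInv_a_of_true ht)) hx
      | b => rw [hpad, h'']; rfl
  · right
    rcases drop_actInf_cases s y n with h' | ⟨r, hs, hpad, h'⟩
    · rw [h, hy] at h'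
      exact absurd h' hx
    · rw [h, hy] at h'
      rw [hy] at hpad
      cases r with
      | a => exact absurd (h'.trans (actInf_a_of_true ht)) hx
      | b => rw [← h, hs, ← hpad]

/-- The orbit is exhausted by the sets of words sharing the tail of `v` from position `n`. Since `v`
is not eventually zero, `n` can be taken arbitrarily large with `v n = 1`, where
`outer_neighbor_drop` applies. -/
theorem hasSmallCuts_two {v : Word} (hv : ¬ Exceptional v) :
    (schreier v).toSimple.HasSmallCuts 2 := by
  classical
  refine hasSmallCuts_of_exhaustion (fun n => {u | drop n u = drop n v})
    (fun n => finite_setOf_drop_eq n _) ?_ ?_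
  · intro u hu
    obtain ⟨m, hm⟩ := (mem_orbit_iff hv).1 hu
    exact ⟨m, fun n hn => drop_congr_of_le hn hm⟩
  · intro m
    obtain ⟨n, hn, hvn⟩ : ∃ n ≥ m, v n = true := by
      by_contra! hc
      exact hv (Or.inl ⟨m, fun i hi => by simpa using hc i hi⟩)
    refine ⟨n, hn, {pad n (actInfInv State.b (drop n v)),
      actInf (Gen.swap^[n] Gen.b).state (pad n (drop n v))}, Finset.card_le_two, ?_⟩
    intro x hx y hy s h
    rw [Finset.mem_insert, Finset.mem_singleton]
    exact outer_neighbor_drop (by simpa [drop] using hvn) hx hy h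

theorem not_hasFourEnds {v : Word} (hv : ¬ Exceptional v) : ¬ (schreier v).HasFourEnds := by
  have : Nonempty (schreier v).V := ⟨⟨v, MulAction.mem_orbit_self v⟩⟩
  exact (hasSmallCuts_two hv).card_end_ne (schreier_preconnected v) (by norm_num)

/-- Reduces the tail `a(0^ω)` to `b(0^ω)` one position later; the latter begins with `1`, as
`outer_neighbor_drop` requires. -/
theorem drop_one_actInf_a_zero : drop 1 (actInf State.a zero) = actInf State.b zero := by
  rw [drop_actInf]
  rfl

/-- The exhausting set joins three blocks: tail `0^ω` at `n`, and tail `b(0^ω)` at `n` or at `n +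
1`. Each alternating block has two outer neighbours, one of which is `0^ω` and hence inside the set.
The remaining two, and the two by which the zero block is entered, make four. -/
theorem hasSmallCuts_zero : (schreier zero).toSimple.HasSmallCuts 4 := by
  classical
  have h1 : actInf State.b zero 0 = true := rfl
  refine hasSmallCuts_of_exhaustion (fun n => {u | drop n u = zero} ∪
    ({u | drop n u = actInf State.b zero} ∪ {u | drop (n + 1) u = actInf State.b zero}))
    (fun n => (finite_setOf_drop_eq n _).union
      ((finite_setOf_drop_eq n _).union (finite_setOf_drop_eq (n + 1) _))) ?_ ?_
  · intro u hu
    rcases mem_orbit_zero_iff.1 hu with ⟨m, hm⟩ | ⟨m, hm⟩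
    · exact ⟨m, fun n hn => Or.inl (funext fun i => hm (n + i) (by omega))⟩
    · refine ⟨m, fun n hn => Or.inr ?_⟩
      obtain ⟨s, hs⟩ := drop_eq_actInf_zero (n := n) fun i hi => hm i (by omega)
      cases s with
      | b => exact Or.inl hs
      | a =>
        right
        change drop (n + 1) u = _
        rw [← drop_drop, hs]
        exact drop_one_actInf_a_zero
  · intro n
    refine ⟨n, le_rfl, {pad n (actInfInv State.a zero), pad n (actInfInv State.b zero),
      actInf (Gen.swap^[n] Gen.b).state (pad n (actInf State.b zero)),
      actInf (Gen.swap^[n + 1] Gen.b).state (pad (n + 1) (actInf State.b zero))},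
      Finset.card_le_four, ?_⟩
    intro x hx y hy s h
    simp only [Set.mem_union, Set.mem_ofPred_eq, not_or] at hx hy
    obtain ⟨hx0, hx1, hx2⟩ := hx
    simp only [Finset.mem_insert, Finset.mem_singleton]
    have hxz : x ≠ zero := by
      rintro rfl
      exact hx0 rfl
    rcases hy with hy | hy | hy
    · rcases h with h | h
      · rcases drop_actInf_cases s x n with h' | ⟨r, -, hpad, h'⟩
        · rw [h, hy] at h'
          exact absurd h'.symm hx0
        · rw [h, hy] at h'
          have h'' : drop n x = actInfInv r.state zero := by rw [h', actInfInv_actInf]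
          rw [h''] at hpad
          cases r with
          | a => exact Or.inl hpad
          | b => exact Or.inr (Or.inl hpad)
      -- An edge leaving the zero block changes the tail to `a(0^ω)` or `b(0^ω)`, so it ends in an
      -- alternating block.
      · exfalso
        rcases drop_actInf_cases s y n with h' | ⟨r, -, -, h'⟩
        · rw [h, hy] at h'
          exact hx0 h'
        · rw [h, hy] at h'
          cases r with
          | a =>
            apply hx2
            rw [← drop_drop, h']
            exact drop_one_actInf_a_zero
          | b => exact hx1 h'
    · rcases outer_neighbor_drop h1 hx1 hy h with h' | h'
      · rw [actInfInv_actInf, pad_zero] at h'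
        exact absurd h' hxz
      · exact Or.inr (Or.inr (Or.inl h'))
    · rcases outer_neighbor_drop h1 hx2 hy h with h' | h'
      · rw [actInfInv_actInf, pad_zero] at h'
        exact absurd h' hxz
      · exact Or.inr (Or.inr (Or.inr h'))

/-! ### The four components of the complement of `0^ω` -/

/-- The last letter `1` of `u` is at position `k`. -/
def LastOne (u : Word) (k : ℕ) : Prop := u k = true ∧ ∀ i > k, u i = false

/-- Eventually, `u` has the letter `1` exactly at the even positions. -/
def EvenPhase (u : Word) : Prop := ∃ n, ∀ i ≥ n, u i = decide (i % 2 = 0)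

open Classical in
/-- An index for the components of the complement of `0^ω` in its Schreier graph. -/
noncomputable def branch (u : Word) : Fin 4 :=
  if ∃ k, LastOne u k ∧ k % 2 = 0 then 0
  else if ∃ k, LastOne u k then 1
  else if EvenPhase u then 2 else 3

theorem LastOne.unique {u : Word} {k l : ℕ} (hk : LastOne u k) (hl : LastOne u l) : k = l := by
  rcases lt_trichotomy k l with h | h | h
  · exact absurd ((hk.2 l h).symm.trans hl.1) (by simp)
  · exact h
  · exact absurd ((hl.2 k h).symm.trans hk.1) (by simp)

theorem branch_of_lastOne {u : Word} {k : ℕ} (h : LastOne u k) :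
    branch u = if k % 2 = 0 then 0 else 1 := by
  unfold branch
  by_cases hk : k % 2 = 0
  · rw [if_pos ⟨k, h, hk⟩, if_pos hk]
  · rw [if_neg, if_pos ⟨k, h⟩, if_neg hk]
    rintro ⟨l, hl, hl'⟩
    rw [h.unique hl] at hk
    exact hk hl'

theorem branch_of_not {u : Word} (h : ¬ ∃ k, LastOne u k) [Decidable (EvenPhase u)] :
    branch u = if EvenPhase u then 2 else 3 := by
  unfold branch
  rw [if_neg (fun ⟨k, hk, _⟩ => h ⟨k, hk⟩), if_neg h]
  congr

theorem LastOne.eventuallyZero {u : Word} {k : ℕ} (h : LastOne u k) : EventuallyZero u :=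
  ⟨k + 1, fun i hi => h.2 i (by omega)⟩

theorem EventuallyZero.exists_lastOne {u : Word} (h : EventuallyZero u) (hu : u ≠ zero) :
    ∃ k, LastOne u k := by
  classical
  obtain ⟨n, hn⟩ := h
  obtain ⟨k, hk⟩ := exists_true_of_ne_zero hu
  have hkn : k ≤ n := by
    by_contra! hlt
    rw [hn k hlt.le] at hk
    exact absurd hk (by simp)
  refine ⟨Nat.findGreatest (fun i => u i = true) n,
    Nat.findGreatest_spec (P := fun i => u i = true) hkn hk, fun i hi => ?_⟩
  by_cases hin : i ≤ n
  · simpa using Nat.findGreatest_is_greatest hi hin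
  · exact hn i (by omega)

theorem EvenPhase.of_drop_eq {n : ℕ} {u v : Word} (h : drop n u = drop n v) (hu : EvenPhase u) :
    EvenPhase v := by
  obtain ⟨m, hm⟩ := hu
  refine ⟨max m n, fun i hi => ?_⟩
  rw [← apply_eq_of_drop_eq h (by omega), hm i (by omega)]

/-- The generators preserve the parity of the position of the last `1`. -/
theorem LastOne.exists_actInf {u : Word} {k : ℕ} (h : LastOne u k) (s : Gen)
    (hne : actInf s.state u ≠ zero) : ∃ l, LastOne (actInf s.state u) l ∧ l % 2 = k % 2 := by
  have htail : ∀ i > k, actInf s.state u i = false := by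
    intro i hi
    rw [apply_eq_of_drop_eq (drop_actInf_of_true s.state h.1 (Nat.lt_succ_self k)) hi]
    exact h.2 i hi
  cases hk : actInf s.state u k with
  | true => exact ⟨k, ⟨hk, htail⟩, rfl⟩
  | false =>
    -- The letter at `k` can be flipped only in state `b`, so only zeros precede it.
    have hzero : ∀ i < k, u i = false := by
      intro i hi
      by_contra hc
      rw [Bool.not_eq_false] at hc
      rw [actInf, stateAt_eq_e hc hi, out, h.1] at hk
      exact absurd hk (by simp)
    have hval : ∀ i < k, actInf s.state u i = out (Gen.swap^[i] s).state false := by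
      intro i hi
      rw [actInf, stateAt_of_zeros fun j hj => hzero j (by omega), hzero i hi]
    have hb : Gen.swap^[k] s = Gen.b := by
      rw [actInf, stateAt_of_zeros hzero, h.1] at hk
      revert hk
      cases Gen.swap^[k] s <;> simp [out, Gen.state]
    -- For `k = 0` and `k = 1` the image would be `0^ω`. Otherwise the states at `k - 2`, `k - 1`,
    -- `k` are `b`, `a`, `b`, so the last `1` moves from `k` to `k - 2`.
    match k, hb, hval, htail, hk with
    | 0, hb, hval, htail, hk =>
      refine absurd (funext fun i => ?_) hne
      rcases Nat.eq_zero_or_pos i with rfl | hi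
      · exact hk
      · exact htail i hi
    | 1, hb, hval, htail, hk =>
      refine absurd (funext fun i => ?_) hne
      rcases i with _ | _ | i
      · rw [hval 0 (by omega)]
        cases s
        · rfl
        · exact absurd hb (by simp [Gen.swap])
      · exact hk
      · exact htail _ (by omega)
    | k + 2, hb, hval, htail, hk =>
      rw [Function.iterate_succ_apply', Function.iterate_succ_apply', Gen.swap_involutive] at hb
      refine ⟨k, ⟨?_, fun i hi => ?_⟩, by omega⟩
      · rw [hval k (by omega), hb]
        rfl
      · rcases (by omega : i = k + 1 ∨ i = k + 2 ∨ k + 2 < i) with rfl | rfl | hi'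
        · rw [hval _ (by omega), Function.iterate_succ_apply', hb]
          rfl
        · exact hk
        · exact htail i hi'

/-- For eventually zero words the parity of the last `1` is preserved; the phase of the other words
depends only on the tail, which does not change because `u ≠ 0^ω`. -/
theorem branch_actInf {u : Word} (s : Gen) (hu : u ≠ zero) (hne : actInf s.state u ≠ zero) :
    branch (actInf s.state u) = branch u := by
  classical
  obtain ⟨m, hm⟩ := exists_true_of_ne_zero hu
  have hd := drop_actInf_of_true s.state hm (Nat.lt_succ_self m)
  by_cases h : ∃ k, LastOne u k
  · obtain ⟨k, hk⟩ := h
    obtain ⟨l, hl, hlk⟩ := hk.exists_actInf s hne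
    rw [branch_of_lastOne hk, branch_of_lastOne hl, hlk]
  · have h' : ¬ ∃ k, LastOne (actInf s.state u) k := by
      rintro ⟨k, hk⟩
      exact h ((hk.eventuallyZero.of_drop_eq hd).exists_lastOne hu)
    rw [branch_of_not h, branch_of_not h']
    exact if_congr ⟨fun h => h.of_drop_eq hd, fun h => h.of_drop_eq hd.symm⟩ rfl rfl

/-- The inverse automaton moves along output letters: in state `b` it turns the first `0` into `1`
and stops. Hence `b⁻¹(0^ω) = 10^ω`, and likewise `a⁻¹(0^ω) = 010^ω`. -/
theorem stateAtInv_b_zero (i : ℕ) : stateAtInv State.b zero (i + 1) = State.e := by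
  induction i with
  | zero => rfl
  | succ i ih => rw [stateAtInv, ih]; rfl

theorem stateAtInv_a_zero (i : ℕ) : stateAtInv State.a zero (i + 2) = State.e := by
  induction i with
  | zero => rfl
  | succ i ih => rw [stateAtInv, ih]; rfl

theorem lastOne_actInfInv_b_zero : LastOne (actInfInv State.b zero) 0 := by
  refine ⟨rfl, fun i hi => ?_⟩
  obtain ⟨i, rfl⟩ := Nat.exists_eq_succ_of_ne_zero hi.ne'
  rw [actInfInv, Nat.succ_eq_add_one, stateAtInv_b_zero]
  rfl

theorem lastOne_actInfInv_a_zero : LastOne (actInfInv State.a zero) 1 := by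
  refine ⟨rfl, fun i hi => ?_⟩
  obtain ⟨i, rfl⟩ := Nat.exists_eq_add_of_le' (show 2 ≤ i from hi)
  rw [actInfInv, stateAtInv_a_zero]
  rfl

theorem actInf_b_zero : actInf State.b zero = fun i => decide (i % 2 = 0) := by
  refine alternating_eq (actInf_zero_succ Gen.b) (fun i => ?_) rfl
  rw [← decide_not, decide_eq_decide]
  omega

theorem actInf_a_zero : actInf State.a zero = fun i => decide (i % 2 = 1) := by
  refine alternating_eq (actInf_zero_succ Gen.a) (fun i => ?_) rfl
  rw [← decide_not, decide_eq_decide]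
  omega

theorem branch_eq_two {u : Word} {n : ℕ} (h : ∀ i ≥ n, u i = decide (i % 2 = 0)) :
    branch u = 2 := by
  classical
  rw [branch_of_not, if_pos ⟨n, h⟩]
  rintro ⟨k, -, hk⟩
  have h₁ := hk (2 * (n + k) + 2) (by omega)
  rw [h _ (by omega)] at h₁
  simp at h₁

theorem branch_eq_three {u : Word} {n : ℕ} (h : ∀ i ≥ n, u i = decide (i % 2 = 1)) :
    branch u = 3 := by
  classical
  rw [branch_of_not, if_neg]
  · rintro ⟨m, hm⟩
    have h₁ := hm (2 * (n + m)) (by omega)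
    rw [h _ (by omega)] at h₁
    simp at h₁
  · rintro ⟨k, -, hk⟩
    have h₁ := hk (2 * (n + k) + 1) (by omega)
    rw [h _ (by omega)] at h₁
    simp [Nat.add_mod] at h₁

/-- Every component of the complement of `0^ω` is infinite. -/
theorem infinite_branch (i : Fin 4) :
    {p : (schreier zero).V | p ≠ (⟨zero, MulAction.mem_orbit_self zero⟩ :
      MulAction.orbit basilica zero) ∧ branch p.1 = i}.Infinite := by
  -- The first `1` of `w m` stands at `2m` or `2m + 1`, whichever parity the branch needs; so `m`
  -- can be recovered from `w m`, and `w m ≠ 0^ω`.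
  suffices h : ∃ w : ℕ → Word, ∀ m, Exceptional (w m) ∧ branch (w m) = i ∧
      ∃ j, 2 * m ≤ j ∧ j ≤ 2 * m + 1 ∧ w m j = true ∧ ∀ l < j, w m l = false by
    obtain ⟨w, hw⟩ := h
    refine Set.infinite_of_injective_forall_mem
      (f := fun m => (⟨w m, mem_orbit_zero_iff.2 (hw m).1⟩ : MulAction.orbit basilica zero))
      (fun m n hmn => ?_) (fun m => ⟨fun hz => ?_, (hw m).2.1⟩)
    · have hmn' : w m = w n := congrArg Subtype.val hmn
      obtain ⟨-, -, j, h₁, h₂, h₃, h₄⟩ := hw m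
      obtain ⟨-, -, k, h₁', h₂', h₃', h₄'⟩ := hw n
      rw [hmn'] at h₃ h₄
      have hjk : j = k := by
        rcases lt_trichotomy j k with h | h | h
        · exact absurd ((h₄' j h).symm.trans h₃) (by simp)
        · exact h
        · exact absurd ((h₄ k h).symm.trans h₃') (by simp)
      omega
    · obtain ⟨-, -, j, -, -, h₃, -⟩ := hw m
      rw [show w m = zero from congrArg Subtype.val hz] at h₃
      exact absurd h₃ (by simp [zero])
  have hlast : ∀ k, LastOne (fun j => decide (j = k)) k := fun k =>
    ⟨by simp, fun j hj => by simp; omega⟩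
  fin_cases i
  · refine ⟨fun m j => decide (j = 2 * m), fun m => ⟨Or.inl (hlast _).eventuallyZero, ?_,
      2 * m, le_rfl, by omega, by simp, fun l hl => by simp; omega⟩⟩
    rw [branch_of_lastOne (hlast (2 * m)), if_pos (by omega)]
    rfl
  · refine ⟨fun m j => decide (j = 2 * m + 1), fun m => ⟨Or.inl (hlast _).eventuallyZero, ?_,
      2 * m + 1, by omega, by omega, by simp, fun l hl => by simp; omega⟩⟩
    rw [branch_of_lastOne (hlast (2 * m + 1)), if_neg (by omega)]
    rfl
  · have h : ∀ m, ∀ j ≥ 2 * m, decide (2 * m ≤ j ∧ j % 2 = 0) = decide (j % 2 = 0) :=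
      fun m j hj => by rw [decide_eq_decide]; omega
    refine ⟨fun m j => decide (2 * m ≤ j ∧ j % 2 = 0), fun m => ⟨Or.inr ⟨2 * m, fun j hj => ?_⟩,
      branch_eq_two (h m), 2 * m, le_rfl, by omega, by simp, fun l hl => by simp; omega⟩⟩
    rw [← decide_not, decide_eq_decide]
    omega
  · have h : ∀ m, ∀ j ≥ 2 * m, decide (2 * m ≤ j ∧ j % 2 = 1) = decide (j % 2 = 1) :=
      fun m j hj => by rw [decide_eq_decide]; omega
    refine ⟨fun m j => decide (2 * m ≤ j ∧ j % 2 = 1), fun m => ⟨Or.inr ⟨2 * m, fun j hj => ?_⟩,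
      branch_eq_three (h m), 2 * m + 1, by omega, by omega, by simp,
      fun l hl => by simp; omega⟩⟩
    rw [← decide_not, decide_eq_decide]
    omega

theorem actInfInv_mem_orbit (s : State) (v : Word) :
    actInfInv s v ∈ MulAction.orbit basilica v := by
  have := actInf_mem_orbit s (actInfInv s v)
  rw [actInf_actInfInv] at this
  exact mem_orbit_comm.1 this

/-- The neighbours of `0^ω`. -/
def zeroNeighbor : Fin 4 → MulAction.orbit basilica zero :=
  ![⟨actInfInv State.b zero, actInfInv_mem_orbit _ _⟩,
    ⟨actInfInv State.a zero, actInfInv_mem_orbit _ _⟩,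
    ⟨actInf State.b zero, actInf_mem_orbit _ _⟩,
    ⟨actInf State.a zero, actInf_mem_orbit _ _⟩]

theorem branch_zeroNeighbor (i : Fin 4) : branch (zeroNeighbor i).1 = i := by
  fin_cases i
  · exact branch_of_lastOne lastOne_actInfInv_b_zero
  · exact branch_of_lastOne lastOne_actInfInv_a_zero
  · exact branch_eq_two (n := 0) fun i _ => congrFun actInf_b_zero i
  · exact branch_eq_three (n := 0) fun i _ => congrFun actInf_a_zero i

theorem zeroNeighbor_ne (i : Fin 4) : (zeroNeighbor i).1 ≠ zero := by
  fin_cases i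
  · exact fun h => Bool.noConfusion (congrFun h 0)
  · exact fun h => Bool.noConfusion (congrFun h 1)
  · exact fun h => Bool.noConfusion (congrFun h 0)
  · exact fun h => Bool.noConfusion (congrFun h 1)

/-- The lower bound comes from the cut vertex `0^ω` with its four infinite branches, the upper bound
from `hasSmallCuts_zero`. -/
theorem hasFourEnds_zero : (schreier zero).HasFourEnds := by
  have : Nonempty (schreier zero).V := ⟨⟨zero, MulAction.mem_orbit_self zero⟩⟩
  have : Infinite (schreier zero).V :=
    Set.infinite_univ_iff.1 ((infinite_branch 0).mono (Set.subset_univ _))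
  let _ : (schreier zero).toSimple.LocallyFinite := fun p =>
    have := finite_neighborSet zero p
    Fintype.ofFinite _
  have : Fact (schreier zero).toSimple.Preconnected := ⟨schreier_preconnected zero⟩
  suffices h : ∃ e : Fin 4 → (schreier zero).toSimple.end, Function.Injective e by
    obtain ⟨e, he⟩ := h
    exact hasSmallCuts_zero.card_end_eq (schreier_preconnected zero) e he
  refine SimpleGraph.exists_injective_end (G := (schreier zero).toSimple)
    (⟨zero, MulAction.mem_orbit_self zero⟩ : MulAction.orbit basilica zero)
    (fun p => branch p.1) (fun x y hx hy hxy => ?_) zeroNeighbor branch_zeroNeighbor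
    (fun i h => zeroNeighbor_ne i (congrArg Subtype.val h)) (fun x hx => ?_) infinite_branch
  · have hx' : x.1 ≠ zero := fun h => hx (Subtype.ext h)
    have hy' : y.1 ≠ zero := fun h => hy (Subtype.ext h)
    obtain ⟨-, s, h | h⟩ := schreier_adj.1 hxy
    · rw [← h] at hy' ⊢
      exact (branch_actInf s hx' hy').symm
    · rw [← h] at hx' ⊢
      exact branch_actInf s hy' hx'
  · obtain ⟨-, s, h | h⟩ := schreier_adj.1 hx
    · have h' : x.1 = actInfInv s.state zero := by
        rw [← actInfInv_actInf s.state x.1, h]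
      cases s with
      | a => exact ⟨1, Subtype.ext h'⟩
      | b => exact ⟨0, Subtype.ext h'⟩
    · cases s with
      | a => exact ⟨3, Subtype.ext h.symm⟩
      | b => exact ⟨2, Subtype.ext h.symm⟩

/-- Points of the same orbit have the same orbital Schreier graph. -/
theorem schreier_isLabelledIso {u v : Word} (h : u ∈ MulAction.orbit basilica v) :
    (schreier u).IsLabelledIso (schreier v) := by
  let f := Equiv.setCongr (MulAction.orbit_eq_iff.2 h)
  exact ⟨f, f.prodCongr (Equiv.refl Gen), fun e => ⟨rfl, rfl, rfl⟩⟩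


/-! ### Sequences of steps and infinite words -/

/-- The sequence of steps `c` appends, from the position `2` on, the letters of `v`. -/
def Follows (c : ℕ → Step) (v : Word) : Prop :=
  ∀ n, app (c n).letters (drop (level c (n + 1)) v) = drop (level c n) v

/-- The step whose letters stand at position `p` of `v`. -/
def stepAt (v : Word) (p : ℕ) : Step :=
  if v p then Step.one else if v (p + 1) then Step.zeroOne else Step.zeroZero

/-- The positions of the successive steps in `v`. -/
def stepPos (v : Word) : ℕ → ℕ
  | 0 => 2
  | n + 1 => stepPos v n + (stepAt v (stepPos v n)).len

theorem cons_drop_succ (v : Word) (p : ℕ) : cons (v p) (drop (p + 1) v) = drop p v := by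
  rw [← cons_drop_one (drop p v), drop_drop]
  rfl

theorem app_stepAt (v : Word) (p : ℕ) :
    app (stepAt v p).letters (drop (p + (stepAt v p).len) v) = drop p v := by
  rw [← cons_drop_succ v p]
  unfold stepAt
  cases h0 : v p with
  | true => rfl
  | false =>
    rw [← cons_drop_succ v (p + 1)]
    cases h1 : v (p + 1) <;> rfl

/-- The blocks `1`, `00`, `01` form a complete prefix code, so `v` can be cut into blocks greedily
from position 2. -/
theorem exists_follows_of_word (v : Word) : ∃ c, Follows c v := by
  refine ⟨fun n => stepAt v (stepPos v n), fun n => ?_⟩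
  have h : ∀ n, level (fun n => stepAt v (stepPos v n)) n = stepPos v n := by
    intro n
    induction n with
    | zero => rfl
    | succ n ih => rw [level, ih, stepPos]
  rw [h, h]
  exact app_stepAt v _

/-- The word `00` followed by the letters of the first `n` steps. -/
def stepPrefix (c : ℕ → Step) : ℕ → List Bool
  | 0 => [false, false]
  | n + 1 => stepPrefix c n ++ (c n).letters

theorem length_stepPrefix (c : ℕ → Step) (n : ℕ) : (stepPrefix c n).length = level c n := by
  induction n with
  | zero => rfl
  | succ n ih => rw [stepPrefix, List.length_append, ih, Step.length_letters, level]

theorem le_level (c : ℕ → Step) (n : ℕ) : n + 2 ≤ level c n := by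
  induction n with
  | zero => exact le_rfl
  | succ n ih =>
    have : 1 ≤ (c n).len := by cases c n <;> simp [Step.len]
    rw [level]
    omega

theorem stepPrefix_isPrefix (c : ℕ → Step) {m n : ℕ} (h : m ≤ n) :
    stepPrefix c m <+: stepPrefix c n := by
  induction n, h using Nat.le_induction with
  | base => exact List.prefix_rfl
  | succ n _ ih => exact ih.trans (List.prefix_append _ _)

theorem getD_stepPrefix (c : ℕ → Step) {m n i : ℕ} (hm : i < level c m) (hn : i < level c n) :
    (stepPrefix c m).getD i false = (stepPrefix c n).getD i false := by
  wlog h : m ≤ n generalizing m n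
  · exact (this hn hm (by omega)).symm
  obtain ⟨t, ht⟩ := stepPrefix_isPrefix c h
  rw [← ht, List.getD_append]
  rwa [length_stepPrefix]

theorem app_apply_of_lt {w : List Bool} {t : Word} {i : ℕ} (h : i < w.length) :
    app w t i = w.getD i false := by
  induction w generalizing i with
  | nil => simp at h
  | cons c w ih =>
    cases i with
    | zero => rfl
    | succ i =>
      rw [List.getD_cons_succ]
      exact ih (by simpa using h)

theorem exists_follows_of_steps (c : ℕ → Step) : ∃ v, Follows c v := by
  -- The default letter is never used, since the `i`-th prefix has length at least `i + 2`. The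
  -- initial `00` is arbitrary: `Follows` constrains only the positions from 2 on.
  let v : Word := fun i => (stepPrefix c i).getD i false
  have hv : ∀ n, v = app (stepPrefix c n) (drop (level c n) v) := by
    intro n
    funext i
    by_cases hi : i < level c n
    · rw [app_apply_of_lt (by rwa [length_stepPrefix])]
      exact getD_stepPrefix c (by have := le_level c i; omega) hi
    · obtain ⟨j, rfl⟩ := Nat.exists_eq_add_of_le (not_lt.1 hi)
      have := congrFun (drop_app (stepPrefix c n) (drop (level c n) v)) j
      rw [length_stepPrefix] at this
      exact this.symm
  refine ⟨v, fun n => ?_⟩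
  have h := (hv (n + 1)).symm.trans (hv n)
  rw [stepPrefix, app_append] at h
  exact (app_injective rfl h).2

/-! ### Boundary points -/

theorem of_step {F : ℕ → Type} {f : ∀ n, F n → F (n + 1)} (n : ℕ) (p : F n) :
    (SeqLim.of (n + 1) (f n p) : SeqLim F f) = SeqLim.of n p :=
  (Quot.sound (r := fun p q : Σ n, F n => q = ⟨p.1 + 1, f p.1 p.2⟩) (a := ⟨n, p⟩) rfl).symm

theorem exists_of_eq {F : ℕ → Type} {f : ∀ n, F n → F (n + 1)} (p : SeqLim F f) :
    ∃ n, ∀ m ≥ n, ∃ q : F m, SeqLim.of m q = p := by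
  obtain ⟨⟨n, q⟩, rfl⟩ := Quot.exists_rep p
  refine ⟨n, fun m hm => ?_⟩
  induction m, hm using Nat.le_induction with
  | base => exact ⟨q, rfl⟩
  | succ m _ ih =>
    obtain ⟨r, hr⟩ := ih
    exact ⟨f m r, (of_step m r).trans hr⟩

/-- The vertex of the blowup represented by a vertex of the `n`-th graph. -/
abbrev vertexAt (c : ℕ → Step) (n : ℕ) (q : GVert (level c n)) : BlowupV c := SeqLim.of n q

/-- The edge of the blowup represented by an edge of the `n`-th graph. -/
noncomputable abbrev edgeAt (c : ℕ → Step) (n : ℕ) (d : GEdge (level c n)) : BlowupE c :=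
  SeqLim.of n d

theorem vertexAt_step (c : ℕ → Step) (n : ℕ) (q : GVert (level c n)) :
    vertexAt c (n + 1) (stepV (level c n) (c n) q) = vertexAt c n q :=
  of_step (f := fun n => stepV (level c n) (c n)) n q

theorem edgeAt_step (c : ℕ → Step) (n : ℕ) (d : GEdge (level c n)) :
    edgeAt c (n + 1) (stepE (level c n) (c n) d) = edgeAt c n d :=
  of_step (f := fun n => stepE (level c n) (c n)) n d

/-- The predicate on the vertices of `G_n` which holds at `0^{n-1}x` if `P` does, and at `0^{n-1}y`
if `Q` does. -/
def GVert.boundaryPred (P Q : Prop) {n : ℕ} : GVert n → Prop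
  | GVert.inner _ _ => False
  | GVert.x => P
  | GVert.y => Q

theorem boundaryPred_stepV {P Q P' Q' : Prop} (t : Step) (hP : P ↔ t = Step.zeroZero ∧ P')
    (hQ : Q ↔ t = Step.zeroOne ∧ Q') {n : ℕ} (q : GVert n) :
    (stepV n t q).boundaryPred P' Q' = q.boundaryPred P Q := by
  cases t <;> cases q <;> simp [stepV, GVert.boundaryPred, hP, hQ]

theorem forall_ge_iff {c : ℕ → Step} {n : ℕ} {t : Step} :
    (∀ m ≥ n, c m = t) ↔ c n = t ∧ ∀ m ≥ n + 1, c m = t := by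
  refine ⟨fun h => ⟨h n le_rfl, fun m hm => h m (by omega)⟩, fun h m hm => ?_⟩
  rcases Nat.eq_or_lt_of_le hm with rfl | hm
  · exact h.1
  · exact h.2 m hm

/-- The vertices of the blowup that are represented by boundary vertices from some level on. -/
def staysBoundary (c : ℕ → Step) : BlowupV c → Prop :=
  SeqLim.desc
    (fun n q => q.boundaryPred (∀ m ≥ n, c m = Step.zeroZero) (∀ m ≥ n, c m = Step.zeroOne))
    (fun n q => boundaryPred_stepV (c n) forall_ge_iff forall_ge_iff q)

/-- A predicate on the direct limit may be evaluated at any representative, and this one is false at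
interior words. -/
theorem hasBoundaryPoint_of_staysBoundary {c : ℕ → Step} {p : BlowupV c}
    (h : staysBoundary c p) : HasBoundaryPoint c := by
  refine ⟨p, ?_⟩
  rintro n q rfl
  cases q with
  | inner w hw => exact h
  | x => trivial
  | y => trivial

theorem stepV_x_of_isBoundary {n : ℕ} {t : Step} (h : (stepV n t GVert.x).IsBoundary) :
    t = Step.zeroZero ∧ stepV n t GVert.x = GVert.x := by
  cases t
  · exact h.elim
  · exact ⟨rfl, rfl⟩
  · exact h.elim

theorem stepV_y_of_isBoundary {n : ℕ} {t : Step} (h : (stepV n t GVert.y).IsBoundary) :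
    t = Step.zeroOne ∧ stepV n t GVert.y = GVert.y := by
  cases t
  · exact h.elim
  · exact h.elim
  · exact ⟨rfl, rfl⟩

/-- The vertex `p` of the blowup is a boundary point. -/
def IsBoundaryPoint {c : ℕ → Step} (p : BlowupV c) : Prop :=
  ∀ (n : ℕ) (q : GVert (level c n)), vertexAt c n q = p → q.IsBoundary

theorem IsBoundaryPoint.of_x {c : ℕ → Step} {p : BlowupV c} (hp : IsBoundaryPoint p) {n : ℕ}
    (h : vertexAt c n GVert.x = p) : ∀ m ≥ n, c m = Step.zeroZero := by
  suffices h' : ∀ m ≥ n, vertexAt c m GVert.x = p by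
    intro m hm
    exact (stepV_x_of_isBoundary (hp (m + 1) _ ((vertexAt_step c m GVert.x).trans (h' m hm)))).1
  intro m hm
  induction m, hm using Nat.le_induction with
  | base => exact h
  | succ m _ ih =>
    have h₁ := (vertexAt_step c m GVert.x).trans ih
    have h₂ := (stepV_x_of_isBoundary (hp (m + 1) _ h₁)).2
    rw [h₂] at h₁
    exact h₁

theorem IsBoundaryPoint.of_y {c : ℕ → Step} {p : BlowupV c} (hp : IsBoundaryPoint p) {n : ℕ}
    (h : vertexAt c n GVert.y = p) : ∀ m ≥ n, c m = Step.zeroOne := by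
  suffices h' : ∀ m ≥ n, vertexAt c m GVert.y = p by
    intro m hm
    exact (stepV_y_of_isBoundary (hp (m + 1) _ ((vertexAt_step c m GVert.y).trans (h' m hm)))).1
  intro m hm
  induction m, hm using Nat.le_induction with
  | base => exact h
  | succ m _ ih =>
    have h₁ := (vertexAt_step c m GVert.y).trans ih
    have h₂ := (stepV_y_of_isBoundary (hp (m + 1) _ h₁)).2
    rw [h₂] at h₁
    exact h₁

/-- The vertex `x` stays on the boundary only under `00`, and `y` only under `01`; every other step
makes it interior, and interior vertices stay interior. -/
theorem hasBoundaryPoint_iff {c : ℕ → Step} : HasBoundaryPoint c ↔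
    (∃ n, ∀ m ≥ n, c m = Step.zeroZero) ∨ (∃ n, ∀ m ≥ n, c m = Step.zeroOne) := by
  constructor
  · rintro ⟨p, hp⟩
    obtain ⟨n, hn⟩ := exists_of_eq p
    obtain ⟨q, hq⟩ := hn n le_rfl
    cases q with
    | inner w h => exact (hp n _ hq).elim
    | x => exact Or.inl ⟨n, IsBoundaryPoint.of_x hp hq⟩
    | y => exact Or.inr ⟨n, IsBoundaryPoint.of_y hp hq⟩
  · rintro (⟨n, h⟩ | ⟨n, h⟩)
    · exact hasBoundaryPoint_of_staysBoundary (p := vertexAt c n GVert.x) h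
    · exact hasBoundaryPoint_of_staysBoundary (p := vertexAt c n GVert.y) h

theorem Follows.exceptional_iff {c : ℕ → Step} {v : Word} (hf : Follows c v) :
    Exceptional v ↔ HasBoundaryPoint c := by
  rw [hasBoundaryPoint_iff]
  constructor
  · rintro (⟨n, h⟩ | ⟨n, h⟩)
    · refine Or.inl ⟨n, fun m hm => ?_⟩
      have h0 : ∀ i, drop (level c m) v i = false := fun i =>
        h (level c m + i) (by have := le_level c m; omega)
      rw [← hf m] at h0
      revert h0
      cases c m with
      | one => exact fun h0 => absurd (h0 0) Bool.noConfusion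
      | zeroZero => exact fun _ => rfl
      | zeroOne => exact fun h0 => absurd (h0 1) Bool.noConfusion
    · have h0 : ∀ m ≥ n, ∀ i, drop (level c m) v (i + 1) = !drop (level c m) v i := fun m hm i =>
        h (level c m + i) (by have := le_level c m; omega)
      -- In an alternating tail only the blocks `1` and `01` occur. Both end in `1`, so the next
      -- block begins with `0`; thus from level index `n + 1` on every block is `01`.
      have h1 : ∀ m ≥ n, drop (level c (m + 1)) v 0 = false := by
        intro m hm
        have h2 := h0 m hm
        rw [← hf m] at h2
        revert h2
        cases c m with
        | one => exact fun h2 => h2 0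
        | zeroZero => exact fun h2 => absurd (h2 0) Bool.noConfusion
        | zeroOne => exact fun h2 => h2 1
      refine Or.inr ⟨n + 1, fun m hm => ?_⟩
      obtain ⟨k, rfl⟩ := Nat.exists_eq_add_of_le' hm
      have h2 := h0 (k + (n + 1)) (by omega) 0
      have h3 : drop (level c (k + (n + 1))) v 0 = false := h1 (k + n) (by omega)
      rw [← hf (k + (n + 1))] at h2 h3
      revert h2 h3
      cases c (k + (n + 1)) with
      | one => exact fun _ h3 => absurd h3 Bool.noConfusion
      | zeroZero => exact fun h2 => absurd h2 Bool.noConfusion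
      | zeroOne => exact fun _ _ => rfl
  · rintro (⟨n, h⟩ | ⟨n, h⟩)
    · have h0 : ∀ i, ∀ m ≥ n, drop (level c m) v i = false := by
        intro i
        -- Position `i + 2` at one level is position `i` at the next, so all levels are treated at
        -- once.
        induction i using Nat.strong_induction_on with
        | _ i ih =>
          intro m hm
          rw [← hf m, h m hm]
          match i, ih with
          | 0, _ => rfl
          | 1, _ => rfl
          | i + 2, ih => exact ih i (by omega) (m + 1) (by omega)
      refine Or.inl ⟨level c n, fun i hi => ?_⟩
      obtain ⟨j, rfl⟩ := Nat.exists_eq_add_of_le hi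
      exact h0 j n le_rfl
    · have h0 : ∀ i, ∀ m ≥ n, drop (level c m) v (i + 1) = !drop (level c m) v i := by
        intro i
        induction i using Nat.strong_induction_on with
        | _ i ih =>
          intro m hm
          have h1 : drop (level c (m + 1)) v 0 = false := by
            rw [← hf (m + 1), h (m + 1) (by omega)]
            rfl
          rw [← hf m, h m hm]
          match i, ih with
          | 0, _ => rfl
          | 1, _ => exact h1
          | i + 2, ih => exact ih i (by omega) (m + 1) (by omega)
      refine Or.inr ⟨level c n, fun i hi => ?_⟩
      obtain ⟨j, rfl⟩ := Nat.exists_eq_add_of_le hi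
      exact h0 j n le_rfl

/-! ### Blowups without boundary points -/

/-- The point of the orbit of `wt`, for words `w` of length `n`, which corresponds to a vertex of
`G_n`. -/
def GVert.toWord (t : Word) {n : ℕ} : GVert n → Word
  | GVert.inner w _ => app w t
  | GVert.x => app (zeros n) t
  | GVert.y => app (zeros n) (actInfInv State.a t)

theorem zeros_add_two (n : ℕ) : zeros (n + 2) = zeros n ++ [false, false] := by
  simp [zeros, List.replicate_succ']

/-- At `y` the three steps rest on `a⁻¹(1t) = 1t`, `a⁻¹(00t) = 01t` and `a⁻¹(01t) = 00a⁻¹(t)`. These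
identities explain the substitutions for `y` in `ι`. -/
theorem toWord_stepV (t : Word) {n : ℕ} (s : Step) (q : GVert n) :
    (stepV n s q).toWord t = q.toWord (app s.letters t) := by
  cases q with
  | inner w h => exact app_append _ _ _
  | x =>
    cases s with
    | one => exact app_append _ _ _
    | zeroZero =>
      change app (zeros (n + 2)) t = _
      rw [zeros_add_two]
      exact app_append _ _ _
    | zeroOne => exact app_append _ _ _
  | y =>
    cases s with
    | one =>
      change app (zeros n ++ [true]) t = app (zeros n) (actInfInv State.a (cons true t))
      rw [app_append, actInfInv_a_of_true rfl]
      rfl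
    | zeroZero =>
      have h : cons false (cons false t) = actInf State.a (cons false (cons true t)) := by
        rw [actInf_cons]
        change _ = cons false (actInf State.b (cons true t))
        rw [actInf_cons, trans_true, actInf_e]
        rfl
      change app (zeros n ++ [false, true]) t =
        app (zeros n) (actInfInv State.a (cons false (cons false t)))
      rw [h, actInfInv_actInf, app_append]
      rfl
    | zeroOne =>
      have h : cons false (cons true t) =
          actInf State.a (cons false (cons false (actInfInv State.a t))) := by
        rw [actInf_cons]
        change _ = cons false (actInf State.b (cons false (actInfInv State.a t)))
        rw [actInf_cons]
        change _ = cons false (cons true (actInf State.a (actInfInv State.a t)))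
        rw [actInf_actInfInv]
      change app (zeros (n + 2)) (actInfInv State.a t) =
        app (zeros n) (actInfInv State.a (cons false (cons true t)))
      rw [h, actInfInv_actInf, zeros_add_two, app_append]
      rfl

/-- After an interior word the state is trivial, so an edge arriving at `x` keeps the tail `t`. The
edge at `y` passes through `0^n` and leaves it in state `a`, so the tail `a⁻¹(t)` at `y` becomes `t`
at the other end. -/
theorem toWord_tgt (t : Word) {n : ℕ} (d : GEdge n) :
    d.tgt.toWord t = actInf d.gen.state (d.src.toWord t) := by
  rcases d.isEdge with ⟨h₁, h₂⟩ | ⟨h₁, h₂⟩ | ⟨h₁, h₂⟩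
  · rw [d.src_inner h₁, d.tgt_inner h₂ rfl]
    simp only [GVert.toWord, actInf_app, h₁.after_eq, actInf_e]
  · rw [d.src_inner h₁, d.tgt_x h₂]
    simp only [GVert.toWord, actInf_app, h₁.after_eq, actInf_e, h₂]
  · rw [d.src_y h₁, d.tgt_inner h₂ rfl]
    rw [h₁] at h₂
    simp only [GVert.toWord, actInf_app, after_zeros_of_isInterior h₂, actInf_actInfInv, h₁]

/-- The points of the boundary of the tree that correspond to the vertices of a blowup. -/
def blowupWord {c : ℕ → Step} {v : Word} (hf : Follows c v) : BlowupV c → Word :=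
  SeqLim.desc (fun n q => q.toWord (drop (level c n) v))
    (fun n q => by rw [← hf n]; exact toWord_stepV _ _ _)

theorem blowupWord_tgt {c : ℕ → Step} {v : Word} (hf : Follows c v) (e : (blowup c).E) :
    blowupWord hf ((blowup c).tgt e) =
      actInf ((blowup c).lab e).state (blowupWord hf ((blowup c).src e)) := by
  obtain ⟨⟨n, d⟩, rfl⟩ := Quot.exists_rep e
  exact toWord_tgt _ d

theorem exists_inner_rep {c : ℕ → Step} (hc : ¬ HasBoundaryPoint c) (p : BlowupV c) :
    ∃ n, ∀ m ≥ n, ∃ w, ∃ h : IsInterior (level c m) w, vertexAt c m (GVert.inner w h) = p := by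
  have hp : ¬ IsBoundaryPoint p := fun h => hc ⟨p, h⟩
  unfold IsBoundaryPoint at hp
  push Not at hp
  obtain ⟨n, q, hq, hqb⟩ := hp
  refine ⟨n, fun m hm => ?_⟩
  induction m, hm using Nat.le_induction with
  | base =>
    cases q with
    | inner w h => exact ⟨w, h, hq⟩
    | x => exact absurd trivial hqb
    | y => exact absurd trivial hqb
  | succ m _ ih =>
    obtain ⟨w, h, hw⟩ := ih
    exact ⟨_, h.append (c m), (vertexAt_step c m _).trans hw⟩

theorem isInterior_word_stepE {n : ℕ} {t : Step} (ht : t ≠ Step.zeroOne) (d : GEdge n) :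
    IsInterior (n + t.len) (stepE n t d).word := by
  change IsInterior _ (stepV n t d.src).addr
  rcases d.cases with h | h
  · rw [d.src_inner h]
    exact h.append t
  · rw [d.src_y h.1]
    cases t with
    | one => exact isInterior_zeros_one n
    | zeroZero => exact isInterior_zeros_zeroOne n
    | zeroOne => exact absurd rfl ht

/-- The source of an edge is interior or `y`, and `y` becomes interior at the first step other than
`01`. Such a step occurs beyond every level, as otherwise there would be a boundary point. -/
theorem exists_interior_edge_rep {c : ℕ → Step} (hc : ¬ HasBoundaryPoint c) (e : BlowupE c) :
    ∃ n, ∀ m ≥ n, ∃ d : GEdge (level c m), edgeAt c m d = e ∧ IsInterior (level c m) d.word := by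
  obtain ⟨n, hn⟩ := exists_of_eq e
  rw [hasBoundaryPoint_iff, not_or] at hc
  have hc' := hc.2
  push Not at hc'
  obtain ⟨k, hk, hck⟩ := hc' n
  refine ⟨k + 1, fun m hm => ?_⟩
  induction m, hm using Nat.le_induction with
  | base =>
    obtain ⟨d, hd⟩ := hn k hk
    exact ⟨_, (edgeAt_step c k d).trans hd,
      isInterior_word_stepE hck d⟩
  | succ m _ ih =>
    obtain ⟨d, hd, hi⟩ := ih
    refine ⟨_, (edgeAt_step c m d).trans hd, ?_⟩
    change IsInterior _ (stepV _ _ d.src).addr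
    rw [d.src_inner hi]
    exact hi.append _

theorem blowupWord_injective {c : ℕ → Step} (hc : ¬ HasBoundaryPoint c) {v : Word}
    (hf : Follows c v) : Function.Injective (blowupWord hf) := by
  intro p q hpq
  obtain ⟨n, hn⟩ := exists_inner_rep hc p
  obtain ⟨m, hm⟩ := exists_inner_rep hc q
  obtain ⟨w, hw, rfl⟩ := hn (max n m) (le_max_left _ _)
  obtain ⟨w', hw', rfl⟩ := hm (max n m) (le_max_right _ _)
  obtain ⟨rfl, -⟩ := app_injective (hw.1.trans hw'.1.symm) hpq
  rfl

theorem blowupWord_mem_orbit {c : ℕ → Step} (hc : ¬ HasBoundaryPoint c) {v : Word}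
    (hf : Follows c v) (p : BlowupV c) : blowupWord hf p ∈ MulAction.orbit basilica v := by
  obtain ⟨n, hn⟩ := exists_inner_rep hc p
  obtain ⟨w, hw, rfl⟩ := hn n le_rfl
  refine mem_orbit_of_drop_eq (n := level c n) ?_
  change drop (level c n) (app w (drop (level c n) v)) = _
  conv_lhs => rw [← hw.1, drop_app, hw.1]

theorem isInterior_append_letters {n : ℕ} {w : List Bool} (hw : w.length = n) {t : Step}
    (ht : t ≠ Step.zeroZero) : IsInterior (n + t.len) (w ++ t.letters) := by
  refine ⟨by rw [List.length_append, hw, t.length_letters], ?_⟩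
  cases t with
  | one => exact ⟨w, 0, rfl⟩
  | zeroZero => exact absurd rfl ht
  | zeroOne => exact ⟨w ++ [false], 0, by simp [Step.letters, zeros]⟩

/-- A point `u` of the orbit is cofinal with `v`. At a late step other than `00` the appended block
ends in `1`, which makes the corresponding prefix of `u` an interior word. -/
theorem exists_blowupWord_eq {c : ℕ → Step} (hc : ¬ HasBoundaryPoint c) {v : Word}
    (hf : Follows c v) {u : Word} (hu : u ∈ MulAction.orbit basilica v) :
    ∃ p, blowupWord hf p = u := by
  obtain ⟨n, hn⟩ := (mem_orbit_iff (hf.exceptional_iff.not.2 hc)).1 hu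
  rw [hasBoundaryPoint_iff, not_or] at hc
  have hc' := hc.1
  push Not at hc'
  obtain ⟨k, hk, hck⟩ := hc' n
  obtain ⟨w, hw, huw⟩ := exists_app_drop (level c k) u
  refine ⟨vertexAt c (k + 1) (GVert.inner _ (isInterior_append_letters hw hck)), ?_⟩
  change app (w ++ (c k).letters) (drop (level c (k + 1)) v) = u
  rw [app_append, hf k, ← drop_congr_of_le (by have := le_level c k; omega) hn, ← huw]

theorem length_act (s : State) (w : List Bool) : (act s w).length = w.length := by
  induction w generalizing s with
  | nil => rfl
  | cons c w ih => simp [act, ih]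

theorem GEdge.eq_of {n : ℕ} {d d' : GEdge n} (hw : d.word = d'.word) (hg : d.gen = d'.gen) :
    d = d' := by
  cases d
  cases d'
  cases hw
  cases hg
  rfl

/-- Edges on both sides are determined by source and label. Injectivity compares two edges at a
common level where both sources are interior. For surjectivity, both ends of a Schreier edge are
interior words of one length at some level, so the finite action relates them and yields an edge
there. -/
theorem blowup_isLabelledIso {c : ℕ → Step} (hc : ¬ HasBoundaryPoint c) {v : Word}
    (hf : Follows c v) : (blowup c).IsLabelledIso (schreier v) := by
  let f : BlowupV c → MulAction.orbit basilica v :=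
    fun p => ⟨blowupWord hf p, blowupWord_mem_orbit hc hf p⟩
  have hfb : Function.Bijective f := by
    refine ⟨fun p q h => blowupWord_injective hc hf (congrArg Subtype.val h), ?_⟩
    rintro ⟨u, hu⟩
    obtain ⟨p, hp⟩ := exists_blowupWord_eq hc hf hu
    exact ⟨p, Subtype.ext hp⟩
  let g : BlowupE c → MulAction.orbit basilica v × Gen :=
    fun e => (f ((blowup c).src e), (blowup c).lab e)
  have hgb : Function.Bijective g := by
    constructor
    · intro e e' h
      obtain ⟨n, hn⟩ := exists_interior_edge_rep hc e
      obtain ⟨m, hm⟩ := exists_interior_edge_rep hc e'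
      obtain ⟨d, rfl, hd⟩ := hn (max n m) (le_max_left _ _)
      obtain ⟨d', rfl, hd'⟩ := hm (max n m) (le_max_right _ _)
      have h₁ : d.src.toWord (drop (level c (max n m)) v) =
        d'.src.toWord (drop (level c (max n m)) v) := congrArg (fun x => (Prod.fst x).1) h
      rw [d.src_inner hd, d'.src_inner hd'] at h₁
      rw [GEdge.eq_of (app_injective (hd.1.trans hd'.1.symm) h₁).1 (congrArg Prod.snd h)]
    · rintro ⟨⟨u, hu⟩, s⟩
      obtain ⟨p, rfl⟩ := exists_blowupWord_eq hc hf hu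
      obtain ⟨q, hq⟩ := exists_blowupWord_eq hc hf
        (mem_orbit_trans (actInf_mem_orbit s.state _) hu)
      obtain ⟨n, hn⟩ := exists_inner_rep hc p
      obtain ⟨m, hm⟩ := exists_inner_rep hc q
      obtain ⟨w, hw, rfl⟩ := hn (max n m) (le_max_left _ _)
      obtain ⟨w', hw', rfl⟩ := hm (max n m) (le_max_right _ _)
      have h : app w' (drop (level c (max n m)) v) =
        actInf s.state (app w (drop (level c (max n m)) v)) := hq
      rw [actInf_app] at h
      obtain ⟨rfl, -⟩ := app_injective (by rw [length_act, hw.1, hw'.1]) h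
      let d : GEdge (level c (max n m)) := ⟨w, s, Or.inl ⟨hw, hw'⟩⟩
      refine ⟨edgeAt c (max n m) d, Prod.ext (Subtype.ext ?_) rfl⟩
      change d.src.toWord (drop (level c (max n m)) v) = app w (drop (level c (max n m)) v)
      rw [d.src_inner hw]
      rfl
  refine ⟨Equiv.ofBijective f hfb, Equiv.ofBijective g hgb, fun e => ⟨rfl, ?_, rfl⟩⟩
  exact Subtype.ext (blowupWord_tgt hf e).symm

/-! ### Blowups with boundary points -/

theorem after_zeros (s : Gen) (n : ℕ) : after s.state (zeros n) = (Gen.swap^[n] s).state := by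
  induction n generalizing s with
  | zero => rfl
  | succ n ih =>
    change after (trans s.state false) (zeros n) = _
    rw [trans_false, ih, Function.iterate_succ_apply]

theorem Gen.state_injective : Function.Injective Gen.state := by
  intro s t h
  cases s <;> cases t <;> first | rfl | cases h

theorem app_zeros_zero (n : ℕ) : app (zeros n) zero = zero := by
  induction n with
  | zero => rfl
  | succ n ih =>
    change cons false (app (zeros n) zero) = zero
    rw [ih]
    exact cons_drop_one zero

theorem lastOne_app (u : List Bool) (k : ℕ) :
    LastOne (app (u ++ true :: zeros k) zero) u.length := by
  have h : drop u.length (app (u ++ true :: zeros k) zero) = cons true zero := by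
    rw [app_append, drop_app]
    change cons true (app (zeros k) zero) = _
    rw [app_zeros_zero]
  refine ⟨congrFun h 0, fun i hi => ?_⟩
  obtain ⟨j, rfl⟩ := Nat.exists_eq_add_of_lt hi
  exact congrFun h (j + 1)

/-- The edge of `G_n` at `0^{n-1}y` is unique. -/
theorem GEdge.eq_of_src_y {n : ℕ} {d d' : GEdge n} (h : d.src = GVert.y) (h' : d'.src = GVert.y) :
    d = d' := by
  -- The generator must be in state `a` after `n` zeros; as `swap` is an involution, this determines
  -- it.
  have key : ∀ d : GEdge n, d.src = GVert.y →
      d.word = zeros n ∧ (Gen.swap^[n] d.gen).state = State.a := by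
    intro d h
    rcases d.cases with hd | ⟨hd, hi⟩
    · rw [d.src_inner hd] at h
      cases h
    · rw [hd] at hi
      exact ⟨hd, by rw [← after_zeros, after_zeros_of_isInterior hi]⟩
  obtain ⟨h₁, h₂⟩ := key d h
  obtain ⟨h₁', h₂'⟩ := key d' h'
  refine GEdge.eq_of (h₁.trans h₁'.symm) ?_
  exact Gen.swap_involutive.injective.iterate n (Gen.state_injective (h₂.trans h₂'.symm))

/-- The edge of `G_n` at `0^{n-1}x` is unique. -/
theorem GEdge.eq_of_tgt_x {n : ℕ} {d d' : GEdge n} (h : d.tgt = GVert.x) (h' : d'.tgt = GVert.x) :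
    d = d' := by
  -- The word followed by `0^ω` is the preimage of `0^ω` under the generator, with its last `1` at
  -- position 1 for `a` and 0 for `b`. An even number of trailing zeros fixes the parity of that
  -- position, hence the generator.
  have key : ∀ d : GEdge n, d.tgt = GVert.x → d.word.length = n ∧
      app d.word zero = actInfInv d.gen.state zero ∧
        ∃ k, LastOne (app d.word zero) k ∧ (n + k) % 2 = 1 := by
    intro d h
    rcases d.isEdge with ⟨-, h₂⟩ | ⟨h₁, h₂⟩ | ⟨-, h₂⟩
    · rw [d.tgt_inner h₂ rfl] at h
      cases h
    · refine ⟨h₁.1, ?_, ?_⟩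
      · rw [← actInfInv_actInf d.gen.state (app d.word zero), actInf_app, h₂, h₁.after_eq,
          actInf_e, app_zeros_zero]
      · obtain ⟨hl, u, j, hu⟩ := h₁
        rw [hu]
        refine ⟨u.length, lastOne_app u _, ?_⟩
        rw [hu] at hl
        simp only [List.length_append, List.length_cons, zeros, List.length_replicate] at hl
        omega
    · rw [d.tgt_inner h₂ rfl] at h
      cases h
  obtain ⟨hl, hw, k, hk, hnk⟩ := key d h
  obtain ⟨hl', hw', k', hk', hnk'⟩ := key d' h'
  have hpos : ∀ (s : Gen) (k : ℕ), LastOne (actInfInv s.state zero) k →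
      k = match s with | Gen.a => 1 | Gen.b => 0 := by
    intro s k hk
    cases s with
    | a => exact hk.unique lastOne_actInfInv_a_zero
    | b => exact hk.unique lastOne_actInfInv_b_zero
  rw [hw] at hk
  rw [hw'] at hk'
  have hg : d.gen = d'.gen := by
    have h₁ := hpos _ _ hk
    have h₂ := hpos _ _ hk'
    revert h₁ h₂
    cases d.gen <;> cases d'.gen <;> intro h₁ h₂ <;> first | rfl | (simp only at h₁ h₂; omega)
  have hww : app d.word zero = app d'.word zero := by rw [hw, hw', hg]
  exact GEdge.eq_of (app_injective (hl.trans hl'.symm) hww).1 hg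

/-- At most one edge of a blowup is incident to a given boundary point. -/
theorem IsBoundaryPoint.edge_unique {c : ℕ → Step} {p : BlowupV c} (hp : IsBoundaryPoint p)
    {e e' : BlowupE c} (h : (blowup c).src e = p ∨ (blowup c).tgt e = p)
    (h' : (blowup c).src e' = p ∨ (blowup c).tgt e' = p) : e = e' := by
  obtain ⟨n, hn⟩ := exists_of_eq e
  obtain ⟨m, hm⟩ := exists_of_eq e'
  obtain ⟨d, rfl⟩ := hn (max n m) (le_max_left _ _)
  obtain ⟨d', rfl⟩ := hm (max n m) (le_max_right _ _)
  generalize max n m = N at *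
  have hsrc : ∀ d : GEdge (level c N), (blowup c).src (edgeAt c N d) = p →
      d.src = GVert.y := by
    intro d hd
    have hb : d.src.IsBoundary := hp N _ hd
    rcases d.cases with h | h
    · rw [d.src_inner h] at hb
      exact hb.elim
    · exact d.src_y h.1
  have htgt : ∀ d : GEdge (level c N), (blowup c).tgt (edgeAt c N d) = p →
      d.tgt = GVert.x := by
    intro d hd
    have hb : d.tgt.IsBoundary := hp N _ hd
    rcases d.isEdge with h | h | h
    · rw [d.tgt_inner h.2 rfl] at hb
      exact hb.elim
    · exact d.tgt_x h.2
    · rw [d.tgt_inner h.2 rfl] at hb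
      exact hb.elim
  -- If `x` and `y` both represented `p`, all later steps would have to be both `00` and `01`.
  have hxy : ∀ d d' : GEdge (level c N), (blowup c).src (edgeAt c N d) = p →
      (blowup c).tgt (edgeAt c N d') = p → False := by
    intro d d' h h'
    have h₁ : vertexAt c N d.src = p := h
    have h₂ : vertexAt c N d'.tgt = p := h'
    rw [hsrc d h] at h₁
    rw [htgt d' h'] at h₂
    have h₃ := hp.of_y h₁ N le_rfl
    rw [hp.of_x h₂ N le_rfl] at h₃
    cases h₃
  rcases h with h | h <;> rcases h' with h' | h'
  · rw [GEdge.eq_of_src_y (hsrc d h) (hsrc d' h')]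
  · exact (hxy d d' h h').elim
  · exact (hxy d' d h' h).elim
  · rw [GEdge.eq_of_tgt_x (htgt d h) (htgt d' h')]

/-- Every vertex of a Schreier graph is the source of an `a`-edge and of a `b`-edge, which are
distinct even if they are loops; a boundary point is incident to at most one edge. -/
theorem not_isIso_of_hasBoundaryPoint {c : ℕ → Step} (hc : HasBoundaryPoint c) (v : Word) :
    ¬ (blowup c).IsIso (schreier v) := by
  rintro ⟨f, g, hfg⟩
  obtain ⟨p, hp⟩ := hc
  have hinc : ∀ s : Gen, (blowup c).src (g.symm (f p, s)) = p ∨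
      (blowup c).tgt (g.symm (f p, s)) = p := by
    intro s
    have hs : (schreier v).src (g (g.symm (f p, s))) = f p :=
      congrArg (schreier v).src (g.apply_symm_apply (f p, s))
    rcases Sym2.eq_iff.1 (hfg (g.symm (f p, s))) with ⟨h₁, -⟩ | ⟨h₁, -⟩
    · exact Or.inl (f.injective (h₁.symm.trans hs))
    · exact Or.inr (f.injective (h₁.symm.trans hs))
  have h := g.symm.injective (IsBoundaryPoint.edge_unique hp (hinc Gen.a) (hinc Gen.b))
  exact Gen.noConfusion (congrArg Prod.snd h)

end Basilica

/-! ### The main theorem, with `v₀ = 0^ω` -/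

theorem mainTheorem7 :
    ∃ v₀ : Basilica.Word,
      -- the exceptional class: the class of orbital Schreier graphs with four ends
      (Basilica.schreier v₀).HasFourEnds ∧
      (∀ v : Basilica.Word, (Basilica.schreier v).HasFourEnds →
        (Basilica.schreier v).IsLabelledIso (Basilica.schreier v₀)) ∧
      -- it is not realized by a blowup
      (∀ c : ℕ → Basilica.Step, ¬ (Basilica.blowup c).IsIso (Basilica.schreier v₀)) ∧
      -- all the other classes are realized by blowups
      (∀ v : Basilica.Word, ¬ (Basilica.schreier v).IsIso (Basilica.schreier v₀) →
        ∃ c : ℕ → Basilica.Step, (Basilica.blowup c).IsLabelledIso (Basilica.schreier v)) ∧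
      -- blowups without boundary points are orbital Schreier graphs
      (∀ c : ℕ → Basilica.Step, ¬ Basilica.HasBoundaryPoint c →
        ∃ v : Basilica.Word, (Basilica.blowup c).IsLabelledIso (Basilica.schreier v)) ∧
      -- those with boundary points are not
      (∀ c : ℕ → Basilica.Step, Basilica.HasBoundaryPoint c →
        ∀ v : Basilica.Word, ¬ (Basilica.blowup c).IsIso (Basilica.schreier v)) := by
  have hexc : ∀ v : Basilica.Word, Basilica.Exceptional v →
      (Basilica.schreier v).IsLabelledIso (Basilica.schreier Basilica.zero) := fun v hv =>
    Basilica.schreier_isLabelledIso (Basilica.mem_orbit_zero_iff.2 hv)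
  refine ⟨Basilica.zero, Basilica.hasFourEnds_zero, fun v hv => hexc v ?_, fun c hiso => ?_,
    fun v hv => ?_, fun c hc => ?_, fun c hc v => Basilica.not_isIso_of_hasBoundaryPoint hc v⟩
  · by_contra hv'
    exact Basilica.not_hasFourEnds hv' hv
  · by_cases hc : Basilica.HasBoundaryPoint c
    · exact Basilica.not_isIso_of_hasBoundaryPoint hc _ hiso
    -- Without boundary points the blowup is a Schreier graph with cuts of size two. The isomorphism
    -- carries these cuts to the graph of `0^ω`, contradicting its four ends.
    · obtain ⟨v, hf⟩ := Basilica.exists_follows_of_steps c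
      obtain ⟨φ⟩ := ((Basilica.blowup_isLabelledIso hc hf).isIso.symm.trans hiso).toSimple
      have : Nonempty (Basilica.schreier Basilica.zero).V :=
        ⟨⟨Basilica.zero, MulAction.mem_orbit_self _⟩⟩
      exact ((Basilica.hasSmallCuts_two (hf.exceptional_iff.not.2 hc)).of_iso φ).card_end_ne
        (Basilica.schreier_preconnected _) (by norm_num) Basilica.hasFourEnds_zero
  · obtain ⟨c, hf⟩ := Basilica.exists_follows_of_word v
    exact ⟨c, Basilica.blowup_isLabelledIso
      (hf.exceptional_iff.not.1 fun h => hv (hexc v h).isIso) hf⟩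
  · obtain ⟨v, hf⟩ := Basilica.exists_follows_of_steps c
    exact ⟨v, Basilica.blowup_isLabelledIso hc hf⟩
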